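/- Let $T$ be a pointed CW complex whose base point $*$ is a $0$-cell. Put $\operatorname{sk}_{-1}(T)=\{*\}$, let $\operatorname{sk}_n(T)$ be the $n$-skeleton for $n\ge 0$, and let $C_n(T)=H_n(\operatorname{sk}_n(T),\operatorname{sk}_{n-1}(T))$ (integral relative singular homology) with differential $\partial:C_{n+1}(T)\to C_n(T)$ the connecting homomorphism of the triple $(\operatorname{sk}_{n+1}(T),\operatorname{sk}_n(T),\operatorname{sk}_{n-1}(T))$; then $H_{n+1}(C_*(T))$ is canonically isomorphic to the reduced homology group $H_{n+1}(T,*)$. Let $(W_*,\partial)$ be a homological complex of abelian groups, let $\rho:C_*(T)\to W_*$ be a homomorphism of complexes, and put $\widetilde W_n=W_n/\operatorname{Im}(\partial:W_{n+1}\to W_n)$. Let $n\ge 0$, $I=[0,1]$ and $S^n=I^n/\partial I^n$. Consider pairs $(f,\omega)$, where $f:S^n\to T$ is a pointed cellular map and $\omega\in\widetilde W_{n+1}$. A cellular homotopy from $(f,\omega)$ to $(f',\omega')$ is a pointed cellular map $H:(S^n\times I)/(\{*\}\times I)\to T$ with $H(x,0)=f(x)$, $H(x,1)=f'(x)$ and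 $$\omega'-\omega=(-1)^{n+1}\rho(H_*([S^n\times I]))\quad\text{in }\widetilde W_{n+1},$$ where $H_*([S^n\times I])\in C_{n+1}(T)$ is the image of the fundamental class of $(I^n\times I,\partial(I^n\times I))$ with its standard orientation. This is an equivalence relation on the set of pairs; let $\widehat\pi_n(T,\rho)$ be the set of equivalence classes $[(f,\omega)]$, pointed by $[(0,0)]$, where $0:S^n\to T$ is the constant map. For $n\ge 1$ the rule $[(f,\omega)]*[(g,\tau)]=[(f*g,\omega+\tau)]$, where $f*g$ is $f$ followed by $g$ along the last coordinate of $I^n$, is well defined and makes $\widehat\pi_n(T,\rho)$ a group with unit $[(0,0)]$. Then for every $n\ge 0$ there is an exact sequence $$\pi_{n+1}(T)\xrightarrow{\ \rho\ }\widetilde W_{n+1}\xrightarrow{\ a\ }\widehat\pi_n(T,\rho)\xrightarrow{\ \zeta\ }\pi_n(T)\to 0,$$ where the first map, a homomorphism, is the composite $$\pi_{n+1}(T)\xrightarrow{\text{Hurewicz}}H_{n+1}(T,*)\cong H_{n+1}(C_*(T))\xrightarrow{H_{n+1}(\rho)}H_{n+1}(W_*)\subset\widetilde W_{n+1}$$ (so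 that it sends the class of a pointed cellular map $f:S^{n+1}\to T$ to the class of $\rho(f_*([S^{n+1}]))$), $a(\omega)=[(0,\omega)]$, and $\zeta([(f,\omega)])=[f]$. That is, $\zeta$ is surjective, the image of $a$ is the preimage under $\zeta$ of the base point of $\pi_n(T)$, and the image of the first map is the preimage under $a$ of $[(0,0)]$. For $n\ge 1$ the maps $a$ and $\zeta$ are homomorphisms of groups, where the product of $\pi_n(T)$ is also given by concatenation $f*g$. -/

import Mathlib

open CategoryTheory Topology
open scoped unitInterval Topology.Homotopy

universe u v

namespace ModifiedHomotopy

noncomputable section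

/-! ### Pointed CW complexes -/

/-- A pointed CW complex: a CW structure on the whole (Hausdorff) space `T`, together with a base
point that is one of the `0`-cells. -/
class PointedCWComplex (T : Type u) [TopologicalSpace T] [T2Space T] extends
    CWComplex (Set.univ : Set T) where
  /-- the base point -/
  pt : T
  pt_mem : pt ∈ (CWComplex.skeleton (Set.univ : Set T) 0 : Set T)

/-- The skeleta, with the index shifted by one: `skel T 0 = sk₋₁(T)` is the base point, and
`skel T (n + 1) = skₙ(T)`. -/
def skel (T : Type u) [TopologicalSpace T] [T2Space T] [PointedCWComplex T] : ℕ → Set T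
  | 0 => {PointedCWComplex.pt}
  | n + 1 => (CWComplex.skeleton (Set.univ : Set T) (n : ℕ∞) : Set T)

/-! ### Homology of a pair of subcomplexes -/

section PairHomology

variable {K : ChainComplex AddCommGrpCat.{u} ℕ}

/-- Relative `n`-cycles of a pair `A ≤ B` of subcomplexes of `K`: elements of `Bₙ` with boundary
in `A`. -/
def relCycles (B A : ∀ n, AddSubgroup (K.X n)) (n : ℕ) : AddSubgroup (K.X n) :=
  B n ⊓ ⨅ m : ℕ, (A m).comap (K.d n m).hom

/-- Relative `n`-boundaries of the pair: sums of a boundary `∂b`, `b ∈ Bₙ₊₁`, and an element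
of `Aₙ`. -/
def relBoundaries (B A : ∀ n, AddSubgroup (K.X n)) (n : ℕ) : AddSubgroup (K.X n) :=
  (B (n + 1)).map (K.d (n + 1) n).hom ⊔ A n

/-- The homology `Hₙ(B / A)` of a pair `A ≤ B` of subcomplexes of `K`. -/
abbrev PairHomology (B A : ∀ n, AddSubgroup (K.X n)) (n : ℕ) : Type u :=
  relCycles B A n ⧸ (relBoundaries B A n).addSubgroupOf (relCycles B A n)

variable {B A B' A' : ∀ n, AddSubgroup (K.X n)}

lemma mem_relCycles {n : ℕ} {c : K.X n} :
    c ∈ relCycles B A n ↔ c ∈ B n ∧ ∀ m, (K.d n m).hom c ∈ A m := by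
  simp [relCycles, AddSubgroup.mem_inf, AddSubgroup.mem_iInf]

lemma mem_relBoundaries {n : ℕ} {c : K.X n} :
    c ∈ relBoundaries B A n ↔ ∃ b ∈ B (n + 1), ∃ a ∈ A n, (K.d (n + 1) n).hom b + a = c := by
  simp [relBoundaries, AddSubgroup.mem_sup]

lemma d_d_apply (i j k : ℕ) (c : K.X i) : (K.d j k).hom ((K.d i j).hom c) = 0 := by
  rw [← AddMonoidHom.comp_apply, ← AddCommGrpCat.hom_comp, K.d_comp_d]
  rfl

/-- The map `Hₙ(B / A) → Hₙ(B' / A')` induced by inclusions. -/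
def pairIncl (hB : ∀ n, B n ≤ B' n) (hA : ∀ n, A n ≤ A' n) (n : ℕ) :
    PairHomology B A n →+ PairHomology B' A' n :=
  QuotientAddGroup.map _ _
    (AddSubgroup.inclusion (fun _ hc => mem_relCycles.2
      ⟨hB n (mem_relCycles.1 hc).1, fun m => hA m ((mem_relCycles.1 hc).2 m)⟩))
    (by
      rintro ⟨c, hc⟩ h
      rw [AddSubgroup.mem_addSubgroupOf] at h
      obtain ⟨b, hb, a, ha, hab⟩ := mem_relBoundaries.1 h
      exact mem_relBoundaries.2 ⟨b, hB _ hb, a, hA _ ha, hab⟩)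

/-- The connecting homomorphism `Hₙ₊₁(B / A) → Hₙ(A / A')` of a triple, sending the class of a
relative cycle `c` to the class of `∂c`. -/
def pairConnecting (B A A' : ∀ n, AddSubgroup (K.X n)) (n : ℕ) :
    PairHomology B A (n + 1) →+ PairHomology A A' n :=
  QuotientAddGroup.map _ _
    (((K.d (n + 1) n).hom.comp (relCycles B A (n + 1)).subtype).codRestrict
      (relCycles A A' n) (by
        rintro ⟨c, hc⟩
        refine mem_relCycles.2 ⟨(mem_relCycles.1 hc).2 n, fun m => ?_⟩
        have h := d_d_apply (n + 1) n m c
        simp only [AddMonoidHom.comp_apply, AddSubgroup.subtype_apply]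
        rw [h]
        exact zero_mem _))
    (by
      rintro ⟨c, hc⟩ h
      rw [AddSubgroup.mem_addSubgroupOf] at h
      obtain ⟨b, hb, a, ha, hab⟩ := mem_relBoundaries.1 h
      refine mem_relBoundaries.2 ⟨a, ha, 0, zero_mem _, ?_⟩
      change _ = (K.d (n + 1) n).hom c
      change _ = c at hab
      rw [← hab, map_add, d_d_apply, zero_add, add_zero])

/-- A homology class relative to `A₀ ≤ A'` has trivial image under `∂ : Hₙ₊₁(B / A) → Hₙ(A / A')`,
where `A₀ ≤ A`. -/
lemma pairConnecting_pairIncl {A₀ : ∀ n, AddSubgroup (K.X n)} (hA : ∀ n, A₀ n ≤ A n)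
    (hA' : ∀ n, A₀ n ≤ A' n) (n : ℕ) (y : PairHomology B A₀ (n + 1)) :
    pairConnecting B A A' n (pairIncl (fun _ => le_rfl) hA (n + 1) y) = 0 := by
  obtain ⟨⟨c, hc⟩, rfl⟩ := QuotientAddGroup.mk_surjective y
  refine (QuotientAddGroup.eq_zero_iff _).2 ?_
  rw [AddSubgroup.mem_addSubgroupOf]
  exact mem_relBoundaries.2 ⟨0, zero_mem _, _, hA' n ((mem_relCycles.1 hc).2 n), by
    rw [map_zero, zero_add]; rfl⟩

end PairHomology

/-! ### Relative singular homology of pairs of subspaces of a fixed space -/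

section Singular

variable {X : Type u} [TopologicalSpace X]

/-- Coefficients `ℤ`. -/
abbrev Coeff : AddCommGrpCat.{u} := AddCommGrpCat.of (ULift.{u} ℤ)

/-- The singular chain complex of `X` with integral coefficients. -/
abbrev singularChains (X : Type u) [TopologicalSpace X] : ChainComplex AddCommGrpCat.{u} ℕ :=
  ((AlgebraicTopology.singularChainComplexFunctor AddCommGrpCat.{u}).obj Coeff).obj (TopCat.of X)

/-- The singular chain given by one singular simplex. -/
def simplexChain {n : ℕ} (s : C(stdSimplex ℝ (Fin (n + 1)), X)) : (singularChains X).X n :=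
  (SSet.ιChainComplex (TopCat.toSSet.obj (TopCat.of X)) (R := Coeff.{u})
    ((TopCat.toSSetObjEquiv (TopCat.of X) (Opposite.op (SimplexCategory.mk n))).symm s)).hom ⟨1⟩

/-- The face inclusion `Δⁿ → Δⁿ⁺¹` opposite to the vertex `i`. -/
def faceMap {n : ℕ} (i : Fin (n + 2)) :
    C(stdSimplex ℝ (Fin (n + 1)), stdSimplex ℝ (Fin (n + 2))) :=
  ⟨stdSimplex.map i.succAbove, stdSimplex.continuous_map _⟩

lemma d_simplexChain {n : ℕ} (s : C(stdSimplex ℝ (Fin (n + 2)), X)) :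
    ((singularChains X).d (n + 1) n).hom (simplexChain s) =
      ∑ i : Fin (n + 2), (-1 : ℤ) ^ i.val • simplexChain (s.comp (faceMap i)) := by
  have h := SSet.ιChainComplex_d (R := Coeff.{u}) (TopCat.toSSet.obj (TopCat.of X))
    ((TopCat.toSSetObjEquiv (TopCat.of X) (Opposite.op (SimplexCategory.mk (n + 1)))).symm s)
  have h2 := congrArg (fun f => f.hom (⟨1⟩ : ULift.{u} ℤ)) h
  have h3 : ∀ {ι : Type} (t : Finset ι) {A B : AddCommGrpCat.{u}} (f : ι → (A ⟶ B)) (a : A),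
      (∑ i ∈ t, f i).hom a = ∑ i ∈ t, (f i).hom a := by
    intro ι t A B f a
    classical
    induction t using Finset.induction_on with
    | empty => simp
    | insert i t hi ih => simp [Finset.sum_insert hi, ih]
  refine h2.trans ((h3 _ _ _).trans (Finset.sum_congr rfl fun i _ => ?_))
  rfl

/-- The singular chains of the subspace `A ⊆ X`, as a subgroup of the singular chains of `X`. -/
def chainsIn (A : Set X) (n : ℕ) : AddSubgroup ((singularChains X).X n) :=
  AddSubgroup.closure {c | ∃ s : C(stdSimplex ℝ (Fin (n + 1)), X), (∀ t, s t ∈ A) ∧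
    c = simplexChain s}

lemma chainsIn_mono {A B : Set X} (h : A ⊆ B) (n : ℕ) : chainsIn A n ≤ chainsIn B n :=
  AddSubgroup.closure_mono fun _ ⟨s, hs, hc⟩ => ⟨s, fun t => h (hs t), hc⟩

lemma simplexChain_mem {A : Set X} {n : ℕ} (s : C(stdSimplex ℝ (Fin (n + 1)), X))
    (hs : ∀ t, s t ∈ A) : simplexChain s ∈ chainsIn A n :=
  AddSubgroup.subset_closure ⟨s, hs, rfl⟩

/-- The relative singular homology group `Hₙ(B, A; ℤ)`, for `A ⊆ B ⊆ X`. -/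
abbrev RelHomology (n : ℕ) (B A : Set X) : Type u := PairHomology (chainsIn B) (chainsIn A) n

/-- The map `Hₙ(B, A) → Hₙ(B', A')` induced by inclusions `B ⊆ B'` and `A ⊆ A'`. -/
def relIncl (n : ℕ) {B A B' A' : Set X} (hB : B ⊆ B') (hA : A ⊆ A') :
    RelHomology n B A →+ RelHomology n B' A' :=
  pairIncl (chainsIn_mono hB) (chainsIn_mono hA) n

/-- The connecting homomorphism `Hₙ₊₁(B, A) → Hₙ(A, A')` of the triple `A' ⊆ A ⊆ B`. -/
def connecting (n : ℕ) (B A A' : Set X) : RelHomology (n + 1) B A →+ RelHomology n A A' :=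
  pairConnecting (chainsIn B) (chainsIn A) (chainsIn A') n

/-! ### The fundamental chain of a cube -/

/-- The affine simplex `Δⁿ → Iⁿ` of the standard triangulation of the cube belonging to the
permutation `p`: its `k`-th vertex is `e_{p 0} + ⋯ + e_{p (k - 1)}`. -/
def cubeSimplex {n : ℕ} (p : Equiv.Perm (Fin n)) : C(stdSimplex ℝ (Fin (n + 1)), Fin n → I) where
  toFun t j := ⟨∑ k with (p.symm j).castSucc < k, t k,
    Finset.sum_nonneg fun k _ => t.2.1 k,
    (Finset.sum_le_sum_of_subset_of_nonneg (Finset.filter_subset _ _)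
      fun k _ _ => t.2.1 k).trans t.2.2.le⟩
  continuous_toFun := by
    refine continuous_pi fun j => Continuous.subtype_mk ?_ _
    exact continuous_finsetSum _ fun k _ => (continuous_apply k).comp continuous_subtype_val

/-- The image under `f : Iⁿ → X` of the fundamental chain of the cube `Iⁿ`, that is, of the sum of
the simplices of its standard triangulation, oriented by the standard orientation of `ℝⁿ`. -/
def cubeChain {n : ℕ} (f : C(Fin n → I, X)) : (singularChains X).X n :=
  ∑ p : Equiv.Perm (Fin n),
    ((Equiv.Perm.sign p : ℤˣ) : ℤ) • simplexChain (f.comp (cubeSimplex p))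

lemma faceMap_self {n : ℕ} (i : Fin (n + 2)) (t : stdSimplex ℝ (Fin (n + 1))) :
    faceMap i t i = 0 := by
  change FunOnFinite.linearMap ℝ ℝ i.succAbove t i = 0
  rw [FunOnFinite.linearMap_apply_apply]
  refine Finset.sum_eq_zero fun k hk => ?_
  exact absurd (Finset.mem_filter.1 hk).2 (Fin.succAbove_ne i k)

lemma cubeSimplex_apply {n : ℕ} (p : Equiv.Perm (Fin n)) (t : stdSimplex ℝ (Fin (n + 1)))
    (j : Fin n) : (cubeSimplex p t j : ℝ) = ∑ k with (p.symm j).castSucc < k, t k :=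
  rfl

lemma cubeSimplex_swap {n : ℕ} (p : Equiv.Perm (Fin (n + 1))) (i : Fin n)
    (t : stdSimplex ℝ (Fin (n + 1))) :
    cubeSimplex (p * Equiv.swap i.castSucc i.succ) (faceMap i.succ.castSucc t) =
      cubeSimplex p (faceMap i.succ.castSucc t) := by
  have h0 := faceMap_self i.succ.castSucc t
  ext j
  rw [cubeSimplex_apply, cubeSimplex_apply]
  have key : (p * Equiv.swap i.castSucc i.succ).symm j =
      Equiv.swap i.castSucc i.succ (p.symm j) := by
    rw [Equiv.symm_apply_eq, Equiv.Perm.mul_apply, Equiv.swap_apply_self, Equiv.apply_symm_apply]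
  rw [key, Finset.sum_filter, Finset.sum_filter]
  refine Finset.sum_congr rfl fun k _ => ?_
  by_cases hk : k = i.succ.castSucc
  · rw [hk, h0]; simp
  · have : (Equiv.swap i.castSucc i.succ (p.symm j)).castSucc < k ↔ (p.symm j).castSucc < k := by
      generalize p.symm j = q
      have hk' : (k : ℕ) ≠ i + 1 := fun h => hk (Fin.ext (by simpa using h))
      rw [Equiv.swap_apply_def]
      split_ifs with h1 h2
      · subst h1; simp only [Fin.lt_def, Fin.val_castSucc, Fin.val_succ]; omega
      · subst h2; simp only [Fin.lt_def, Fin.val_castSucc, Fin.val_succ]; omega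
      · rfl
    simp only [this]

lemma cubeSimplex_face_zero {n : ℕ} (p : Equiv.Perm (Fin (n + 1)))
    (t : stdSimplex ℝ (Fin (n + 1))) :
    cubeSimplex p (faceMap 0 t) ∈ Cube.boundary (Fin (n + 1)) := by
  refine ⟨p 0, Or.inr (Subtype.ext ?_)⟩
  change _ = (1 : ℝ)
  rw [cubeSimplex_apply, Equiv.symm_apply_apply, ← (faceMap 0 t).2.2, Finset.sum_filter]
  refine Finset.sum_congr rfl fun k _ => ?_
  split_ifs with h
  · rfl
  · have : k = 0 := by simpa using h
    subst this
    exact (faceMap_self 0 t).symm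

lemma cubeSimplex_face_last {n : ℕ} (p : Equiv.Perm (Fin (n + 1)))
    (t : stdSimplex ℝ (Fin (n + 1))) :
    cubeSimplex p (faceMap (Fin.last _) t) ∈ Cube.boundary (Fin (n + 1)) := by
  refine ⟨p (Fin.last n), Or.inl (Subtype.ext ?_)⟩
  change _ = (0 : ℝ)
  rw [cubeSimplex_apply, Equiv.symm_apply_apply]
  refine Finset.sum_eq_zero fun k hk => ?_
  have : k = Fin.last (n + 1) := by
    have h := (Finset.mem_filter.1 hk).2
    simp only [Fin.lt_def, Fin.val_castSucc, Fin.val_last] at h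
    exact Fin.ext (by simp only [Fin.val_last]; omega)
  rw [this]
  exact faceMap_self _ t

/-- If `f` maps the cube to `B` and its boundary to `A`, then the image of the fundamental chain is
a relative cycle of `(B, A)`. -/
lemma cubeChain_mem {n : ℕ} {B A : Set X} (f : C(Fin n → I, X)) (hB : ∀ y, f y ∈ B)
    (hA : ∀ y ∈ Cube.boundary (Fin n), f y ∈ A) :
    cubeChain f ∈ relCycles (chainsIn B) (chainsIn A) n := by
  refine mem_relCycles.2 ⟨sum_mem fun p _ => zsmul_mem (simplexChain_mem _ fun t => hB _) _,
    fun m => ?_⟩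
  by_cases hm : m + 1 = n
  swap
  · rw [(singularChains X).shape n m hm]
    exact zero_mem _
  subst hm
  rw [cubeChain, map_sum]
  simp only [map_zsmul, d_simplexChain, Finset.smul_sum]
  rw [Finset.sum_comm]
  refine sum_mem fun i _ => ?_
  induction i using Fin.cases with
  | zero =>
    exact sum_mem fun p _ => zsmul_mem (zsmul_mem (simplexChain_mem _ fun t =>
      hA _ (cubeSimplex_face_zero p t)) _) _
  | succ i =>
    induction i using Fin.lastCases with
    | last =>
      exact sum_mem fun p _ => zsmul_mem (zsmul_mem (simplexChain_mem _ fun t =>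
        hA _ (cubeSimplex_face_last p t)) _) _
    | cast i =>
      convert! AddSubgroup.zero_mem _
      refine Finset.sum_involution (fun p _ => p * Equiv.swap i.castSucc i.succ) ?_ ?_ ?_ ?_
      · intro p _
        have h : (f.comp (cubeSimplex (p * Equiv.swap i.castSucc i.succ))).comp
            (faceMap i.succ.castSucc) = (f.comp (cubeSimplex p)).comp (faceMap i.succ.castSucc) :=
          ContinuousMap.ext fun t => congrArg f (cubeSimplex_swap p i t)
        rw [← Fin.succ_castSucc] at h
        rw [h, Equiv.Perm.sign_mul, Equiv.Perm.sign_swap (Fin.castSucc_lt_succ).ne]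
        simp
      · intro p _ _ h
        have h2 : Equiv.swap i.castSucc i.succ = 1 := mul_eq_left.1 h
        exact (Fin.castSucc_lt_succ (i := i)).ne (Equiv.swap_eq_one_iff.1 h2)
      · intro p _; exact Finset.mem_univ _
      · intro p _; rw [mul_assoc, Equiv.swap_mul_self, mul_one]

/-- The class in `Hₙ(B, A)` of a map of pairs `(Iⁿ, ∂Iⁿ) → (B, A)`: the image of the fundamental
class of `(Iⁿ, ∂Iⁿ)`. -/
def cubeClass {n : ℕ} {B A : Set X} (f : C(Fin n → I, X)) (hB : ∀ y, f y ∈ B)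
    (hA : ∀ y ∈ Cube.boundary (Fin n), f y ∈ A) : RelHomology n B A :=
  QuotientAddGroup.mk ⟨cubeChain f, cubeChain_mem f hB hA⟩

end Singular

/-! ### The cellular chain complex -/

section Cellular

open PointedCWComplex

variable (T : Type u) [TopologicalSpace T] [T2Space T] [PointedCWComplex T]

lemma skel_subset_succ (n : ℕ) : skel T n ⊆ skel T (n + 1) := by
  cases n with
  | zero => exact Set.singleton_subset_iff.2 pt_mem
  | succ n => exact RelCWComplex.skeleton_mono (by exact_mod_cast n.le_succ)

lemma pt_mem_skel (n : ℕ) : (pt : T) ∈ skel T n := by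
  induction n with
  | zero => exact rfl
  | succ n ih => exact skel_subset_succ T n ih

/-- `Cₙ(T) = Hₙ(skₙ(T), skₙ₋₁(T))`. -/
abbrev CellularChains (n : ℕ) : Type u := RelHomology n (skel T (n + 1)) (skel T n)

/-- The differential `Cₙ₊₁(T) → Cₙ(T)`, the connecting homomorphism of the triple
`(skₙ₊₁(T), skₙ(T), skₙ₋₁(T))`. -/
def cellularD (n : ℕ) : CellularChains T (n + 1) →+ CellularChains T n :=
  connecting n (skel T (n + 2)) (skel T (n + 1)) (skel T n)

/-- The homology of `A → B → C` at `B`: kernel modulo image. -/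
abbrev HomologyAt {A B C : Type*} [AddCommGroup A] [AddCommGroup B] [AddCommGroup C]
    (d' : A →+ B) (d : B →+ C) :=
  d.ker ⧸ d'.range.addSubgroupOf d.ker

/-- The homology group `Hₙ₊₁(C_*(T))`. -/
abbrev CellularHomology (n : ℕ) : Type u :=
  HomologyAt (cellularD T (n + 1)) (cellularD T n)

/-- A map `C_*(T) → W_*` of complexes of abelian groups (`Cₙ(T) = 0` for `n < 0`). -/
structure CellularChainMap (W : ChainComplex AddCommGrpCat.{v} ℤ) where
  /-- the component in degree `n` -/
  app (n : ℕ) : CellularChains T n →+ W.X n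
  comm (n : ℕ) (c : CellularChains T (n + 1)) :
    (W.d ((n + 1 : ℕ) : ℤ) (n : ℤ)).hom (app (n + 1) c) = app n (cellularD T n c)
  comm_zero (c : CellularChains T 0) : (W.d ((0 : ℕ) : ℤ) (-1)).hom (app 0 c) = 0

/-- `W̃ₙ = Wₙ / Im ∂`. -/
abbrev Wtilde (W : ChainComplex AddCommGrpCat.{v} ℤ) (n : ℕ) : Type v :=
  W.X n ⧸ (W.d ((n + 1 : ℕ) : ℤ) (n : ℤ)).hom.range

/-- The homology group `Hₙ₊₁(W_*)`. -/
abbrev WHomology (W : ChainComplex AddCommGrpCat.{v} ℤ) (n : ℕ) : Type v :=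
  HomologyAt (W.d ((n + 1 + 1 : ℕ) : ℤ) ((n + 1 : ℕ) : ℤ)).hom
    (W.d ((n + 1 : ℕ) : ℤ) (n : ℤ)).hom

/-- The inclusion `Hₙ₊₁(W_*) ⊆ W̃ₙ₊₁`. -/
def homologyToTilde (W : ChainComplex AddCommGrpCat.{v} ℤ) (n : ℕ) :
    WHomology W n →+ Wtilde W (n + 1) :=
  QuotientAddGroup.map _ _ (W.d ((n + 1 : ℕ) : ℤ) (n : ℤ)).hom.ker.subtype (fun _ h => h)

variable {T}

/-- The map `Hₙ₊₁(ρ) : Hₙ₊₁(C_*(T)) → Hₙ₊₁(W_*)`. -/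
def CellularChainMap.homologyMap {W : ChainComplex AddCommGrpCat.{v} ℤ} (ρ : CellularChainMap T W)
    (n : ℕ) : CellularHomology T n →+ WHomology W n :=
  QuotientAddGroup.map _ _
    (((ρ.app (n + 1)).comp (cellularD T n).ker.subtype).codRestrict _ (by
      rintro ⟨c, hc⟩
      rw [AddMonoidHom.mem_ker] at hc ⊢
      change (W.d ((n + 1 : ℕ) : ℤ) (n : ℤ)).hom (ρ.app (n + 1) c) = 0
      rw [ρ.comm, hc, map_zero]))
    (by
      rintro ⟨c, hc⟩ ⟨b, hb⟩
      refine ⟨ρ.app (n + 2) b, ?_⟩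
      rw [ρ.comm (n + 1), hb]
      rfl)

/-- The map `Hₙ₊₁(skₙ₊₁(T), *) → Hₙ₊₁(C_*(T))` that sends `y` to the class of its image in
`Hₙ₊₁(skₙ₊₁(T), skₙ(T)) = Cₙ₊₁(T)`. -/
def skelToCellular (n : ℕ) :
    RelHomology (n + 1) (skel T (n + 2)) {pt} →+ CellularHomology T n :=
  (QuotientAddGroup.mk' _).comp
    ((relIncl (n + 1) subset_rfl (Set.singleton_subset_iff.2 (pt_mem_skel T _))).codRestrict
      (cellularD T n).ker (by
        intro y
        exact pairConnecting_pairIncl _ (chainsIn_mono (Set.singleton_subset_iff.2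
          (pt_mem_skel T _))) n y))

/-! ### Cellular maps from spheres and cellular homotopies -/

variable (T)

/-- Pointed cellular maps `Sⁿ = Iⁿ/∂Iⁿ → T`: maps `Iⁿ → T` sending `∂Iⁿ` to the base point, with
image in `skₙ(T)`. -/
structure CellularLoop (n : ℕ) where
  /-- the underlying map -/
  toLoop : GenLoop (Fin n) T pt
  cellular (y : Fin n → I) : toLoop y ∈ skel T (n + 1)

variable {T}

/-- The constant map `0 : Sⁿ → T`. -/
def CellularLoop.const (n : ℕ) : CellularLoop T n :=
  ⟨GenLoop.const, fun _ => pt_mem_skel T _⟩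

/-- The product `f * g`: first `f`, then `g`, along the last coordinate of the cube. -/
def CellularLoop.mul {n : ℕ} (f g : CellularLoop T (n + 1)) : CellularLoop T (n + 1) :=
  ⟨GenLoop.transAt (Fin.last n) f.toLoop g.toLoop, fun y => by
    rw [GenLoop.transAt, GenLoop.coe_copy]
    split_ifs
    · exact f.cellular _
    · exact g.cellular _⟩

/-- A pointed cellular map `H : Sⁿ × I / {*} × I → T` with `H(x, 0) = f(x)`, `H(x, 1) = f'(x)`. -/
structure CellularHomotopy {n : ℕ} (f f' : CellularLoop T n) where
  /-- the underlying map on `Iⁿ × I` -/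
  toMap : C((Fin n → I) × I, T)
  cellular (y : Fin n → I) (s : I) : toMap (y, s) ∈ skel T (n + 2)
  base (y : Fin n → I) (hy : y ∈ Cube.boundary (Fin n)) (s : I) : toMap (y, s) = pt
  map_zero (y : Fin n → I) : toMap (y, 0) = f.toLoop y
  map_one (y : Fin n → I) : toMap (y, 1) = f'.toLoop y

/-- The identification `Iⁿ⁺¹ = Iⁿ × I`, where the last coordinate is the second factor. -/
def cubeSplit (n : ℕ) : C(Fin (n + 1) → I, (Fin n → I) × I) where
  toFun y := (fun i => y i.castSucc, y (Fin.last n))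
  continuous_toFun := by fun_prop

/-- The chain `H_*([Sⁿ × I]) ∈ Cₙ₊₁(T)`. -/
def CellularHomotopy.chain {n : ℕ} {f f' : CellularLoop T n} (H : CellularHomotopy f f') :
    CellularChains T (n + 1) :=
  cubeClass (H.toMap.comp (cubeSplit n)) (fun y => H.cellular _ _) (by
    rintro y ⟨i, hi⟩
    change H.toMap (fun i => y i.castSucc, y (Fin.last n)) ∈ _
    induction i using Fin.lastCases with
    | last =>
      rcases hi with hi | hi
      · rw [hi, H.map_zero]; exact f.cellular _
      · rw [hi, H.map_one]; exact f'.cellular _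
    | cast i =>
      rw [H.base _ ⟨i, hi⟩]; exact pt_mem_skel T _)

/-! ### The modified homotopy groups -/

variable {W : ChainComplex AddCommGrpCat.{v} ℤ} (ρ : CellularChainMap T W)

/-- There is a cellular homotopy `H` from the pair `(f, ω)` to the pair `(f', ω')`, that is, from
`f` to `f'` with `ω' - ω = (-1)ⁿ⁺¹ ρ(H_*([Sⁿ × I]))` in `W̃ₙ₊₁`. -/
def PairHomotopic (n : ℕ) (p q : CellularLoop T n × Wtilde W (n + 1)) : Prop :=
  ∃ H : CellularHomotopy p.1 q.1,
    q.2 - p.2 = (-1 : ℤ) ^ (n + 1) • (QuotientAddGroup.mk (ρ.app (n + 1) H.chain) : Wtilde W (n + 1))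

/-- The set `π̂ₙ(T, ρ)` of homotopy classes of pairs. -/
def PiHat (n : ℕ) : Type (max u v) := Quot (PairHomotopic ρ n)

/-- The class `[(f, ω)]`. -/
def PiHat.mk {n : ℕ} (f : CellularLoop T n) (ω : Wtilde W (n + 1)) : PiHat ρ n :=
  Quot.mk _ (f, ω)

/-- The map `a : W̃ₙ₊₁ → π̂ₙ(T, ρ)`, `a(ω) = [(0, ω)]`. -/
def PiHat.a (n : ℕ) (ω : Wtilde W (n + 1)) : PiHat ρ n :=
  PiHat.mk ρ (CellularLoop.const n) ω

/-- The class in `πₙ(T)` of a pointed map. -/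
def piMk {n : ℕ} (f : GenLoop (Fin n) T pt) : π_ n T pt :=
  Quotient.mk (GenLoop.Homotopic.setoid (Fin n) pt) f

/-- The map `ζ : π̂ₙ(T, ρ) → πₙ(T)`, `ζ[(f, ω)] = [f]`. -/
def PiHat.zeta (n : ℕ) : PiHat ρ n → π_ n T pt :=
  Quot.lift (fun p => piMk p.1.toLoop) (by
    rintro p q ⟨H, -⟩
    refine Quotient.sound ⟨?_⟩
    exact
      { toFun := fun x => H.toMap (x.2, x.1)
        continuous_toFun := by fun_prop
        map_zero_left := fun y => H.map_zero y
        map_one_left := fun y => H.map_one y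
        prop' := fun s y hy => (H.base y hy s).trans (p.1.toLoop.2 y hy).symm })

/-! ### The Hurewicz map -/

/-- The Hurewicz image of `f : Sⁿ → T` in the reduced singular homology group `Hₙ(T, *)`. -/
def singularHurewicz {n : ℕ} (f : GenLoop (Fin n) T pt) :
    RelHomology n (Set.univ : Set T) {pt} :=
  cubeClass f.1 (fun _ => Set.mem_univ _) (fun y hy => f.2 y hy)

/-- For a pointed cellular map `f : Sⁿ → T`, the class `f_*([Sⁿ]) ∈ Hₙ(skₙ(T), *)`. -/
def CellularLoop.class {n : ℕ} (f : CellularLoop T n) :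
    RelHomology n (skel T (n + 1)) {pt} :=
  cubeClass f.toLoop.1 f.cellular (fun y hy => f.toLoop.2 y hy)

/-- `h : πₙ₊₁(T) → Hₙ₊₁(C_*(T))` is the Hurewicz map, where `Hₙ₊₁(C_*(T))` is identified with the
reduced singular homology `Hₙ₊₁(T, *)` by the usual isomorphism: a class in `Hₙ₊₁(T, *)` lifts to
some `y ∈ Hₙ₊₁(skₙ₊₁(T), *)`, and it corresponds to the class of the image of `y` in `Cₙ₊₁(T)`.
On a cellular map `f`, this is the homology class of the chain `f_*([Sⁿ⁺¹]) ∈ Cₙ₊₁(T)`. -/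
structure IsHurewicz (n : ℕ) (h : π_ (n + 1) T pt → CellularHomology T n) : Prop where
  singular (f : GenLoop (Fin (n + 1)) T pt) :
    ∃ y : RelHomology (n + 1) (skel T (n + 2)) {pt},
      relIncl (n + 1) (Set.subset_univ _) subset_rfl y = singularHurewicz f ∧
        h (piMk f) = skelToCellular n y
  cellular (f : CellularLoop T (n + 1)) : h (piMk f.toLoop) = skelToCellular n f.class

end Cellular

end

end ModifiedHomotopy

open ModifiedHomotopy PointedCWComplex

/-! A cellular homotopy between maps `Sⁿ → T` is a map of the cube `Iⁿ⁺¹`, and the theorem rests on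
two facts about such cubes.

The first is additivity of the chain in `Cₙ₊₁(T)`: reversal changes its sign, concatenation in the
homotopy direction or in a loop direction adds, and a homotopy inside `skₙ(T)` contributes 0
(`cubeClass_reverse`, `cubeClass_add`, `cubeClass_eq_zero`). The first two come from the boundary
formula `d_cubeChain`, applied to a cube one dimension higher that is folded onto the given one by a
map `I² → I`.

The second is cellular approximation (`exists_homotopicRel_skeleton`). The image of a cube lies in a
finite subcomplex, whose cells of too large dimension are vacated one at a time: the map is made to
miss the centre of the cell, because a `C¹` image of `ℝᵐ` in `ℝᵏ`, `m < k`, has dense complement,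
and is then pushed radially to the frontier.

Exactness follows. Cellular representatives make `ζ` surjective. If `f` is null-homotopic, a
cellular null-homotopy joins `(f, ω)` to some `(0, ω')`. A cellular homotopy from `0` to `0` is the
same thing as a cellular loop of dimension `n + 1`, and its chain is the class of that loop; hence
`(0, ω) ~ (0, 0)` exactly when `ω` is `ρ` of such a class, the sign being absorbed by reversing the
homotopy. The Hurewicz map is defined on cellular representatives; the chain of a cellular homotopy
between two of them bounds the difference of their classes.

For the group axioms, homotopies inside `skₙ(T)` leave `ω` unchanged, so the laws are inherited from
`πₙ(skₙ(T))` in the first entry and from `W̃ₙ₊₁` in the second. -/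

namespace ModifiedHomotopy

noncomputable section

/-! ### Pushing maps of cubes off cells of higher dimension -/

section Push

open Metric

/-- `C¹` functions on `ℝᵐ`, restricted to a subset of the cube. -/
def smoothFunctions {m : ℕ} (K : Set (Fin m → I)) : Subalgebra ℝ C(K, ℝ) where
  carrier := {h | ∃ P : (Fin m → ℝ) → ℝ, ContDiff ℝ 1 P ∧ ∀ y : K, h y = P fun i => (y.1 i : ℝ)}
  mul_mem' := by
    rintro a b ⟨P, hP, h⟩ ⟨Q, hQ, h'⟩
    exact ⟨_, hP.mul hQ, fun y => by simp [h, h']⟩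
  add_mem' := by
    rintro a b ⟨P, hP, h⟩ ⟨Q, hQ, h'⟩
    exact ⟨_, hP.add hQ, fun y => by simp [h, h']⟩
  algebraMap_mem' r := ⟨fun _ => r, contDiff_const, fun y => by simp⟩

lemma smoothFunctions_separatesPoints {m : ℕ} (K : Set (Fin m → I)) :
    (smoothFunctions K).SeparatesPoints := by
  intro x y hxy
  obtain ⟨i, hi⟩ : ∃ i, x.1 i ≠ y.1 i := by
    by_contra! h
    exact hxy (Subtype.ext (funext h))
  refine ⟨fun z => (z.1 i : ℝ), ⟨⟨fun z => (z.1 i : ℝ),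
    continuous_subtype_val.comp ((continuous_apply i).comp continuous_subtype_val)⟩,
    ⟨fun v => v i, ?_, ?_⟩, rfl⟩,
    fun h => hi (Subtype.ext h)⟩
  · fun_prop
  · intro y; rfl

/-- A continuous map from a closed subset of the `m`-cube to `ℝᵏ`, `m < k`, can be approximated by a
map without zeros. -/
lemma exists_approx_ne_zero {m k : ℕ} (hmk : m < k) {K : Set (Fin m → I)} (hK : IsClosed K)
    {g : (Fin m → I) → Fin k → ℝ} (hg : ContinuousOn g K) {ε : ℝ} (hε : 0 < ε) :
    ∃ p : (Fin m → I) → Fin k → ℝ, Continuous p ∧ (∀ y ∈ K, ‖p y - g y‖ < ε) ∧ ∀ y, p y ≠ 0 := by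
  have : CompactSpace K := isCompact_iff_compactSpace.1 hK.isCompact
  have h1 : ∀ j : Fin k, ∃ P : (Fin m → ℝ) → ℝ, ContDiff ℝ 1 P ∧
      ∀ y ∈ K, ‖P (fun i => (y i : ℝ)) - g y j‖ < ε / 2 := by
    intro j
    have hc : Continuous fun y : K => g y j :=
      (continuous_apply j).comp (continuousOn_iff_continuous_domRestrict.1 hg)
    -- Stone–Weierstrass, one coordinate at a time.
    obtain ⟨⟨a, P, hP, ha⟩, h⟩ :=
      ContinuousMap.exists_mem_subalgebra_near_continuous_of_separatesPoints (smoothFunctions K)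
        (smoothFunctions_separatesPoints K) _ hc (ε / 2) (half_pos hε)
    exact ⟨P, hP, fun y hy => by have := h ⟨y, hy⟩; rwa [ha] at this⟩
  choose P hP hPg using h1
  have hPc : ContDiff ℝ 1 fun v j => P j v := contDiff_pi.2 hP
  -- As `m < k`, the `C¹` image of `ℝᵐ` has dense complement; subtracting a small `z` outside the
  -- image moves the map off 0.
  obtain ⟨z, hz, hz0⟩ := (hPc.dense_compl_range_of_finrank_lt_finrank (by simpa)).exists_dist_lt 0
    (half_pos hε)
  refine ⟨fun y j => P j (fun i => (y i : ℝ)) - z j, ?_, ?_, ?_⟩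
  · have := hPc.continuous
    refine continuous_pi fun j => ((hP j).continuous.comp ?_).sub continuous_const
    fun_prop
  · intro y hy
    have e : (fun j => P j (fun i => (y i : ℝ)) - z j) - g y =
      (fun j => P j (fun i => (y i : ℝ)) - g y j) - z := by ext j; simp; ring
    rw [e]
    refine (norm_sub_le _ _).trans_lt ?_
    rw [dist_zero_left] at hz0
    have : ‖(fun j => P j (fun i => (y i : ℝ)) - g y j)‖ ≤ ε / 2 :=
      (pi_norm_le_iff_of_nonneg (half_pos hε).le).2 fun j => (hPg j y hy).le
    linarith
  · intro y h0
    exact hz ⟨fun i => (y i : ℝ), funext fun j => sub_eq_zero.1 (congrFun h0 j)⟩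

/-- A continuous map from a closed subset of the `m`-cube to `ℝᵏ`, `m < k`, can be modified near its
zeros so as to have no zeros. -/
lemma exists_modify_ne_zero {m k : ℕ} (hmk : m < k) {K : Set (Fin m → I)} (hK : IsClosed K)
    {g : (Fin m → I) → Fin k → ℝ} (hg : ContinuousOn g K) :
    ∃ g' : (Fin m → I) → Fin k → ℝ, ContinuousOn g' K ∧ (∀ y ∈ K, g' y ≠ 0) ∧
      (∀ y ∈ K, 1 / 2 ≤ ‖g y‖ → g' y = g y) ∧ ∀ y ∈ K, ‖g' y - g y‖ < 1 / 4 := by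
  obtain ⟨p, hp, hpg, hp0⟩ := exists_approx_ne_zero hmk hK hg (ε := 1 / 4) (by norm_num)
  -- A cutoff, 1 for `r ≤ 1/4` and 0 for `r ≥ 1/2`. Where `‖g y‖ ≤ 1/4` the new map is `p`;
  -- elsewhere it moves `g` by less than `1/4`, too little to reach 0.
  let β : ℝ → ℝ := fun r => max 0 (min 1 (2 - 4 * r))
  have hβ : Continuous β := by fun_prop
  have hβ0 : ∀ r, 0 ≤ β r := fun r => le_max_left _ _
  have hβ1 : ∀ r, β r ≤ 1 := fun r => max_le zero_le_one (min_le_left _ _)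
  have hle : ∀ y ∈ K, ‖β ‖g y‖ • (p y - g y)‖ < 1 / 4 := by
    intro y hy
    rw [norm_smul, Real.norm_of_nonneg (hβ0 _)]
    exact (mul_le_of_le_one_left (norm_nonneg _) (hβ1 _)).trans_lt (hpg y hy)
  refine ⟨fun y => g y + β ‖g y‖ • (p y - g y), ?_, ?_, ?_, ?_⟩
  · exact hg.add ((hβ.comp_continuousOn hg.norm).smul (hp.continuousOn.sub hg))
  · intro y hy h0
    by_cases h : ‖g y‖ ≤ 1 / 4
    · have : β ‖g y‖ = 1 := by
        simp only [β]
        rw [min_eq_left (by linarith), max_eq_right zero_le_one]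
      simp only [this, one_smul, add_sub_cancel] at h0
      exact hp0 y h0
    · have h1 := hle y hy
      rw [← norm_neg, ← eq_neg_of_add_eq_zero_left h0] at h1
      linarith
  · intro y hy h
    have : β ‖g y‖ = 0 := by
      simp only [β]
      exact max_eq_left ((min_le_right _ _).trans (by linarith))
    simp only [this, zero_smul, add_zero]
  · intro y hy
    rw [add_sub_cancel_left]
    exact hle y hy

/-! ### Deforming a map off a single cell -/

variable {T : Type u} [TopologicalSpace T] [T2Space T] {k : ℕ} {Φ : PartialEquiv (Fin k → ℝ) T}
  {E : Set T}

/-- A map into `E ∪ eᵏ` that misses the centre of the cell `eᵏ` can be pushed radially to `E`. -/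
lemma exists_radial_push {Y : Type*} [TopologicalSpace Y] [CompactSpace Y]
    (hs : Φ.source = ball 0 1) (hc : ContinuousOn Φ (closedBall 0 1)) (hE : IsClosed E)
    (hsph : ∀ w ∈ sphere 0 1, Φ w ∈ E) (hdisj : Disjoint E (Φ '' ball 0 1)) (f : C(Y, T))
    (hf : ∀ y, f y ∈ E ∪ Φ '' ball 0 1) (h0 : ∀ y, f y ≠ Φ 0) :
    ∃ F : C(I × Y, T), (∀ y, F (0, y) = f y) ∧ (∀ s y, f y ∈ E → F (s, y) = f y) ∧
      ∀ y, F (1, y) ∈ E := by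
  classical
  -- The straight line from `w` to `‖w‖⁻¹ • w`.
  let D : ℝ → (Fin k → ℝ) → Fin k → ℝ := fun s w => (1 - s + s * ‖w‖⁻¹) • w
  have hDn : ∀ s : I, ∀ w, w ≠ 0 → ‖w‖ ≤ 1 → ‖D s w‖ ≤ 1 := by
    intro s w hw hw1
    have h1 : 0 < ‖w‖ := norm_pos_iff.2 hw
    have h2 : 0 ≤ (1 - s + s * ‖w‖⁻¹ : ℝ) :=
      add_nonneg (by linarith [s.2.2]) (mul_nonneg s.2.1 (by positivity))
    rw [norm_smul, Real.norm_of_nonneg h2, add_mul, mul_assoc, inv_mul_cancel₀ h1.ne']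
    nlinarith [s.2.1, s.2.2]
  have hD1 : ∀ w, w ≠ 0 → ‖D 1 w‖ = 1 := by
    intro w hw
    have h1 : 0 < ‖w‖ := norm_pos_iff.2 hw
    simp only [D, sub_self, zero_add, one_mul]
    rw [norm_smul, norm_inv, norm_norm, inv_mul_cancel₀ h1.ne']
  have hDs : ∀ s w, ‖w‖ = 1 → D s w = w := by
    intro s w hw
    simp only [D, hw, inv_one, mul_one, sub_add_cancel, one_smul]
  have hlift : ∀ y, f y ∉ E → f y ∈ Φ '' ball 0 1 := fun y hy => (hf y).resolve_left hy
  have hsymm : ∀ w ∈ ball (0 : Fin k → ℝ) 1, Φ.symm (Φ w) = w := fun w hw =>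
    Φ.left_inv (hs ▸ hw)
  let F : I × Y → T := fun x => if f x.2 ∈ E then f x.2 else Φ (D x.1 (Φ.symm (f x.2)))
  -- The preimage of the range of `f` in the closed ball: compact, and away from the centre, so `D`
  -- is continuous on it.
  let Z : Set (Fin k → ℝ) := closedBall 0 1 ∩ Φ ⁻¹' Set.range f
  have hZ : IsCompact Z := (isCompact_closedBall _ _).of_isClosed_subset
    (hc.preimage_isClosed_of_isClosed isClosed_closedBall (isCompact_range f.continuous).isClosed)
    Set.inter_subset_left
  have hZ0 : ∀ w ∈ Z, w ≠ 0 := by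
    rintro w ⟨-, y, hy⟩ rfl
    exact h0 y hy
  have : CompactSpace Z := isCompact_iff_compactSpace.1 hZ
  -- Any preimage `w` of `f y` computes `F`: inside the ball it is unique, and on the sphere, where
  -- `Φ` need not be injective, `D` fixes it.
  have hFZ : ∀ s y, ∀ w ∈ Z, f y = Φ w → F (s, y) = Φ (D s w) := by
    intro s y w hw h
    by_cases hw1 : ‖w‖ = 1
    · have : f y ∈ E := h ▸ hsph w (by simpa using hw1)
      simp only [F, this, if_true]
      rw [hDs _ _ hw1, h]
    · have hwb : w ∈ ball (0 : Fin k → ℝ) 1 := by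
        have := hw.1
        simp only [mem_closedBall, dist_zero_right] at this
        simpa using lt_of_le_of_ne this hw1
      have : f y ∉ E := fun hy => Set.disjoint_left.1 hdisj hy ⟨w, hwb, h.symm⟩
      simp only [F, this, if_false]
      rw [h, hsymm w hwb]
  have hΦ : Continuous fun w : Z => Φ w :=
    continuousOn_iff_continuous_domRestrict.1 (hc.mono Set.inter_subset_left)
  have hΦD : Continuous fun x : (I × Y) × Z => Φ (D x.1.1 x.2) := by
    refine hc.comp_continuous ?_ fun x => ?_
    · have : ∀ x : (I × Y) × Z, ‖(x.2 : Fin k → ℝ)‖ ≠ 0 := fun x => norm_ne_zero_iff.2 (hZ0 _ x.2.2)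
      simp only [D]
      fun_prop (disch := exact this)
    · simpa using hDn x.1.1 x.2 (hZ0 _ x.2.2) (by simpa using x.2.2.1)
  have hF : Continuous F := by
    refine continuous_iff_isClosed.2 fun C hC => ?_
    -- Pasting is not available, since `Φ.symm` is not controlled near the frontier of the cell.
    -- Instead the preimage of a closed set is a closed set together with the projection of a closed
    -- set along the compact `Z`.
    have : F ⁻¹' C = (Prod.snd ⁻¹' (f ⁻¹' (E ∩ C))) ∪
        Prod.fst '' ({x : (I × Y) × Z | f x.1.2 = Φ x.2} ∩ {x | Φ (D x.1.1 x.2) ∈ C}) := by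
      ext ⟨s, y⟩
      constructor
      · intro h
        by_cases hy : f y ∈ E
        · left
          have h' : F (s, y) ∈ C := h
          simp only [F, hy, if_true] at h'
          exact ⟨hy, h'⟩
        · right
          obtain ⟨w, hw, hwy⟩ := hlift y hy
          have hwZ : w ∈ Z := ⟨ball_subset_closedBall hw, y, hwy.symm⟩
          refine ⟨((s, y), ⟨w, hwZ⟩), ⟨hwy.symm, ?_⟩, rfl⟩
          have h' : F (s, y) ∈ C := h
          rwa [hFZ s y w hwZ hwy.symm] at h'
      · rintro (⟨hy, h⟩ | ⟨⟨⟨s', y'⟩, w⟩, ⟨h1, h2⟩, h3⟩)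
        · have hy' : f y ∈ E := hy
          change F (s, y) ∈ C
          simp only [F, hy', if_true]
          exact h
        · obtain ⟨rfl, rfl⟩ := Prod.mk.inj h3
          change F (s', y') ∈ C
          rw [hFZ s' y' w w.2 h1]
          exact h2
    rw [this]
    refine ((hE.inter hC).preimage f.continuous |>.preimage continuous_snd).union
      (isClosedMap_fst_of_compactSpace _ ((isClosed_eq ?_ ?_).inter (hC.preimage hΦD)))
    · fun_prop
    · exact hΦ.comp continuous_snd
  refine ⟨⟨F, hF⟩, fun y => ?_, fun s y hy => if_pos hy, fun y => ?_⟩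
  · by_cases hy : f y ∈ E
    · exact if_pos hy
    · obtain ⟨w, hw, hwy⟩ := hlift y hy
      have hwZ : w ∈ Z := ⟨ball_subset_closedBall hw, y, hwy.symm⟩
      change F (0, y) = _
      rw [hFZ 0 y w hwZ hwy.symm, ← hwy]
      simp [D]
  · change F (1, y) ∈ E
    by_cases hy : f y ∈ E
    · simp only [F, hy, if_true]
    · obtain ⟨w, hw, hwy⟩ := hlift y hy
      have hwZ : w ∈ Z := ⟨ball_subset_closedBall hw, y, hwy.symm⟩
      rw [hFZ 1 y w hwZ hwy.symm]
      exact hsph _ (by simpa using hD1 w (hZ0 w hwZ))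

/-- A map of the `m`-cube into `E ∪ eᵏ`, `m < k`, is homotopic to a map missing the centre of the
cell `eᵏ`, by a homotopy that is constant where the map goes to `E`. -/
lemma exists_homotopy_miss_center {m : ℕ} (hmk : m < k)
    (hs : Φ.source = ball 0 1) (hc : ContinuousOn Φ (closedBall 0 1))
    (hc' : ContinuousOn Φ.symm Φ.target) (hE : IsClosed E)
    (hsph : ∀ w ∈ sphere 0 1, Φ w ∈ E) (hdisj : Disjoint E (Φ '' ball 0 1)) (f : C(Fin m → I, T))
    (hf : ∀ y, f y ∈ E ∪ Φ '' ball 0 1) :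
    ∃ F : C(I × (Fin m → I), T), (∀ y, F (0, y) = f y) ∧ (∀ s y, f y ∈ E → F (s, y) = f y) ∧
      (∀ s y, F (s, y) ∈ E ∪ Φ '' ball 0 1) ∧ ∀ y, F (1, y) ≠ Φ 0 := by
  classical
  have hsymm : ∀ w ∈ ball (0 : Fin k → ℝ) 1, Φ.symm (Φ w) = w := fun w hw =>
    Φ.left_inv (hs ▸ hw)
  have htar : Φ.target = Φ '' ball 0 1 := by rw [← hs]; exact Φ.image_source_eq_target.symm
  have h34 : closedBall (0 : Fin k → ℝ) (3 / 4) ⊆ ball 0 1 := closedBall_subset_ball (by norm_num)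
  have hinj : ∀ w ∈ ball (0 : Fin k → ℝ) 1, ∀ w' ∈ ball (0 : Fin k → ℝ) 1, Φ w = Φ w' → w = w' :=
    fun w hw w' hw' h => by rw [← hsymm w hw, h, hsymm w' hw']
  -- Two closed sets covering the cube. The map is modified on `K` only; on the overlap with `V` the
  -- radius is at least `1/2`, where `g' = g`.
  let K : Set (Fin m → I) := f ⁻¹' (Φ '' closedBall 0 (3 / 4))
  let V : Set (Fin m → I) := f ⁻¹' (E ∪ Φ '' (closedBall 0 1 \ ball 0 (1 / 2)))
  have hK : IsClosed K := (((isCompact_closedBall _ _).image_of_continuousOn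
    (hc.mono (h34.trans ball_subset_closedBall))).isClosed).preimage f.continuous
  have hV : IsClosed V := (hE.union (((isCompact_closedBall _ _).diff isOpen_ball
    ).image_of_continuousOn (hc.mono Set.sdiff_subset)).isClosed).preimage f.continuous
  have hKE : ∀ y ∈ K, f y ∉ E := by
    rintro y ⟨w, hw, hwy⟩ hy
    exact Set.disjoint_left.1 hdisj hy ⟨w, h34 hw, hwy⟩
  let g : (Fin m → I) → Fin k → ℝ := fun y => Φ.symm (f y)
  have hgK : ∀ y ∈ K, ‖g y‖ ≤ 3 / 4 ∧ Φ (g y) = f y := by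
    rintro y ⟨w, hw, hwy⟩
    simp only [g]
    rw [← hwy, hsymm w (h34 hw)]
    exact ⟨by simpa using hw, rfl⟩
  have hg : ContinuousOn g K := hc'.comp f.continuous.continuousOn fun y ⟨w, hw, hwy⟩ => by
    rw [htar]; exact ⟨w, h34 hw, hwy⟩
  obtain ⟨g', hg', hg'0, hgg', hlt⟩ := exists_modify_ne_zero hmk hK hg
  -- The radius is at most `3/4` on `K` and changes by less than `1/4`, so the homotopy stays in the
  -- open cell.
  have hnorm : ∀ s : I, ∀ y ∈ K, g y + (s : ℝ) • (g' y - g y) ∈ ball (0 : Fin k → ℝ) 1 := by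
    intro s y hy
    rw [mem_ball_zero_iff]
    refine (norm_add_le _ _).trans_lt ?_
    rw [norm_smul, Real.norm_of_nonneg s.2.1]
    have := mul_le_of_le_one_left (norm_nonneg (g' y - g y)) s.2.2
    linarith [hlt y hy, (hgK y hy).1]
  let F : I × (Fin m → I) → T := fun x =>
    if x.2 ∈ K then Φ (g x.2 + (x.1 : ℝ) • (g' x.2 - g x.2)) else f x.2
  have hFK : ∀ s, ∀ y ∈ K, F (s, y) = Φ (g y + (s : ℝ) • (g' y - g y)) := fun s y hy => if_pos hy
  have hFV : ∀ s, ∀ y ∈ V, F (s, y) = f y := by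
    intro s y hy
    by_cases hyK : y ∈ K
    · rw [hFK s y hyK]
      obtain hy | ⟨w, hw, hwy⟩ := hy
      · exact absurd hy (hKE y hyK)
      · obtain ⟨w', hw', hwy'⟩ := hyK
        have hwb : w ∈ ball (0 : Fin k → ℝ) 1 := by
          have h1 := hw.1
          rw [mem_closedBall_zero_iff] at h1
          rw [mem_ball_zero_iff]
          refine lt_of_le_of_ne h1 fun h => ?_
          exact Set.disjoint_left.1 hdisj (hsph w (by simpa using h))
            ⟨w', h34 hw', hwy'.trans hwy.symm⟩
        have hgw : g y = w := by simp only [g]; rw [← hwy, hsymm w hwb]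
        have : g' y = g y := hgg' y ⟨w', hw', hwy'⟩ (by
          rw [hgw]; have := hw.2; rw [mem_ball_zero_iff] at this; linarith)
        rw [this, sub_self, smul_zero, add_zero, hgw, hwy]
    · exact if_neg hyK
  have hKV : ∀ y, y ∈ K ∨ y ∈ V := by
    intro y
    rcases hf y with hy | ⟨w, hw, hwy⟩
    · exact Or.inr (Or.inl hy)
    · by_cases h : ‖w‖ ≤ 3 / 4
      · exact Or.inl ⟨w, by simpa using h, hwy⟩
      · refine Or.inr (Or.inr ⟨w, ⟨ball_subset_closedBall hw, ?_⟩, hwy⟩)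
        rw [mem_ball_zero_iff]; linarith
  have hF : Continuous F := by
    rw [← continuousOn_univ]
    have : (Set.univ : Set (I × (Fin m → I))) = Prod.snd ⁻¹' K ∪ Prod.snd ⁻¹' V := by
      ext x; simpa using hKV x.2
    rw [this]
    refine ContinuousOn.union_of_isClosed ?_ ?_ (hK.preimage continuous_snd)
      (hV.preimage continuous_snd)
    · have h1 : ContinuousOn (fun x : I × (Fin m → I) => g x.2) (Prod.snd ⁻¹' K) :=
        hg.comp continuousOn_snd fun _ h => h
      have h2 : ContinuousOn (fun x : I × (Fin m → I) => g' x.2) (Prod.snd ⁻¹' K) :=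
        hg'.comp continuousOn_snd fun _ h => h
      have h3 : ContinuousOn (fun x : I × (Fin m → I) => (x.1 : ℝ)) (Prod.snd ⁻¹' K) := by fun_prop
      have h4 := hc.comp (h1.add (h3.smul (h2.sub h1)))
        fun x hx => ball_subset_closedBall (hnorm x.1 x.2 hx)
      exact h4.congr fun x hx => hFK x.1 x.2 hx
    · exact (f.continuous.comp continuous_snd).continuousOn.congr fun x hx => hFV x.1 x.2 hx
  refine ⟨⟨F, hF⟩, fun y => ?_, fun s y hy => hFV s y (Or.inl hy), fun s y => ?_, fun y => ?_⟩
  · change F (0, y) = _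
    rcases hKV y with hy | hy
    · rw [hFK 0 y hy]; simp [(hgK y hy).2]
    · exact hFV 0 y hy
  · change F (s, y) ∈ _
    rcases hKV y with hy | hy
    · rw [hFK s y hy]; exact Or.inr ⟨_, hnorm s y hy, rfl⟩
    · rw [hFV s y hy]; exact hf y
  · change F (1, y) ≠ _
    by_cases hy : y ∈ K
    · rw [hFK 1 y hy]
      intro h
      have := hinj _ (hnorm 1 y hy) 0 (by simp) h
      simp only [Set.Icc.coe_one, one_smul, add_sub_cancel] at this
      exact hg'0 y hy this
    · intro h
      rw [hFV 1 y ((hKV y).resolve_left hy)] at h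
      exact hy ⟨0, mem_closedBall_self (by norm_num), h.symm⟩

/-- A map of the `m`-cube into `E ∪ eᵏ`, `m < k`, is homotopic to a map into `E`, relative to any
set that goes to `E`. -/
lemma exists_homotopicRel_of_cell {m : ℕ} (hmk : m < k)
    (hs : Φ.source = ball 0 1) (hc : ContinuousOn Φ (closedBall 0 1))
    (hc' : ContinuousOn Φ.symm Φ.target) (hE : IsClosed E)
    (hsph : ∀ w ∈ sphere 0 1, Φ w ∈ E) (hdisj : Disjoint E (Φ '' ball 0 1)) (f : C(Fin m → I, T))
    (hf : ∀ y, f y ∈ E ∪ Φ '' ball 0 1) {S : Set (Fin m → I)} (hS : ∀ y ∈ S, f y ∈ E) :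
    ∃ g : C(Fin m → I, T), f.HomotopicRel g S ∧ ∀ y, g y ∈ E := by
  obtain ⟨F, hF0, hFE, hFm, hF1⟩ := exists_homotopy_miss_center hmk hs hc hc' hE hsph hdisj f hf
  -- The two deformations are composed: off the centre, then radially. Neither moves points that
  -- already lie in `E`.
  let f' : C(Fin m → I, T) := F.comp ⟨fun y => (1, y), by fun_prop⟩
  obtain ⟨G, hG0, hGE, hG1⟩ := exists_radial_push hs hc hE hsph hdisj f' (fun y => hFm 1 y) hF1
  refine ⟨G.comp ⟨fun y => (1, y), by fun_prop⟩,
    ContinuousMap.HomotopicRel.trans (g := f') ?_ ?_, hG1⟩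
  · exact ⟨⟨⟨F, hF0, fun y => rfl⟩, fun s y hy => hFE s y (hS y hy)⟩⟩
  · refine ⟨⟨⟨G, hG0, fun y => rfl⟩, fun s y hy => hGE s y ?_⟩⟩
    change F (1, y) ∈ E
    rw [hFE 1 y (hS y hy)]
    exact hS y hy

end Push

/-! ### Cellular approximation for maps of cubes -/

section CellularApproximation

open RelCWComplex

variable {T : Type u} [TopologicalSpace T] [CWComplex (Set.univ : Set T)]

variable (T) in
/-- The cells of `T`, of all dimensions. -/
abbrev Cells : Type u := Σ n, cell (Set.univ : Set T) n

lemma exists_mem_openCell (x : T) : ∃ c : Cells T, x ∈ openCell c.1 c.2 := by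
  have : x ∈ ⋃ (n : ℕ) (j : cell (Set.univ : Set T) n), openCell n j := by
    rw [CWComplex.iUnion_openCell_eq_complex]; trivial
  simp only [Set.mem_iUnion] at this
  obtain ⟨n, j, h⟩ := this
  exact ⟨⟨n, j⟩, h⟩

lemma eq_of_mem_openCell {x : T} {c c' : Cells T} (h : x ∈ openCell c.1 c.2)
    (h' : x ∈ openCell c'.1 c'.2) : c = c' := by
  by_contra hne
  exact Set.disjoint_left.1 (disjoint_openCell_of_ne hne) h h'

/-- The union of the open cells in a set of cells. -/
def cellUnion (Q : Set (Cells T)) : Set T := ⋃ c ∈ Q, openCell c.1 c.2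

lemma mem_cellUnion {Q : Set (Cells T)} {x : T} :
    x ∈ cellUnion Q ↔ ∃ c ∈ Q, x ∈ openCell c.1 c.2 := by
  simp [cellUnion]

/-- A set of cells whose union is a subcomplex. -/
def IsClosedUnder (Q : Set (Cells T)) : Prop := ∀ c ∈ Q, closedCell c.1 c.2 ⊆ cellUnion Q

lemma cellUnion_mono {Q Q' : Set (Cells T)} (h : Q ⊆ Q') : cellUnion Q ⊆ cellUnion Q' :=
  Set.biUnion_subset_biUnion_left h

lemma isClosedUnder_biUnion {ι : Type*} {s : Set ι} {Q : ι → Set (Cells T)}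
    (h : ∀ i ∈ s, IsClosedUnder (Q i)) : IsClosedUnder (⋃ i ∈ s, Q i) := by
  intro c hc
  simp only [Set.mem_iUnion] at hc
  obtain ⟨i, hi, hc⟩ := hc
  exact (h i hi c hc).trans (cellUnion_mono (Set.subset_biUnion_of_mem hi))

/-- Every cell lies in a finite subcomplex. -/
lemma exists_finite_isClosedUnder_cell (c : Cells T) :
    ∃ Q : Set (Cells T), Q.Finite ∧ IsClosedUnder Q ∧ c ∈ Q := by
  obtain ⟨n, i⟩ := c
  induction n using Nat.strong_induction_on with
  | _ n ih =>
    obtain ⟨J, hJ⟩ := CWComplex.cellFrontier_subset_finite_openCell n i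
    -- Finitely many cells of lower dimension cover the frontier; by induction each lies in a finite
    -- subcomplex.
    let s : Set (Cells T) := ⋃ m ∈ Set.Iio n, Sigma.mk m '' (J m : Set (cell (Set.univ : Set T) m))
    have hs : s.Finite := (Set.finite_Iio n).biUnion fun m _ => (J m).finite_toSet.image _
    have hsn : ∀ c ∈ s, c.1 < n := by
      intro c hc
      simp only [s, Set.mem_iUnion] at hc
      obtain ⟨m, hm, j, -, rfl⟩ := hc
      exact hm
    -- The hypothesis `c ∈ s` sits inside the existential so that `choose` gives a function of `c`
    -- alone.
    have h : ∀ c : Cells T, ∃ Q : Set (Cells T), c ∈ s → Q.Finite ∧ IsClosedUnder Q ∧ c ∈ Q := by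
      rintro ⟨m, j⟩
      by_cases hc : (⟨m, j⟩ : Cells T) ∈ s
      · obtain ⟨Q, hQ⟩ := ih m (hsn _ hc) j
        exact ⟨Q, fun _ => hQ⟩
      · exact ⟨∅, fun h => absurd h hc⟩
    choose Q hQ using h
    have hcl := isClosedUnder_biUnion fun c hc => (hQ c hc).2.1
    refine ⟨insert ⟨n, i⟩ (⋃ c ∈ s, Q c), (hs.biUnion fun c hc => (hQ c hc).1).insert _, ?_,
      Set.mem_insert _ _⟩
    rintro c (rfl | hc)
    · rw [← cellFrontier_union_openCell_eq_closedCell]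
      refine Set.union_subset (fun x hx => ?_) fun x hx =>
        mem_cellUnion.2 ⟨_, Set.mem_insert _ _, hx⟩
      have := hJ hx
      simp only [Set.mem_iUnion] at this
      obtain ⟨m, hm, j, hj, hx⟩ := this
      have hc : (⟨m, j⟩ : Cells T) ∈ s := Set.mem_biUnion hm ⟨j, hj, rfl⟩
      exact mem_cellUnion.2 ⟨⟨m, j⟩, Or.inr (Set.mem_biUnion hc (hQ _ hc).2.2), hx⟩
    · exact (hcl c hc).trans (cellUnion_mono (Set.subset_insert _ _))

variable [T2Space T]

/-- In a subcomplex the open cells have the same union as the closed cells, here a finite union of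
closed sets. -/
lemma IsClosedUnder.isClosed {Q : Set (Cells T)} (hQ : IsClosedUnder Q) (hf : Q.Finite) :
    IsClosed (cellUnion Q) := by
  have : cellUnion Q = ⋃ c ∈ Q, closedCell c.1 c.2 :=
    subset_antisymm (Set.iUnion₂_mono fun c _ => openCell_subset_closedCell _ _)
      (Set.iUnion₂_subset hQ)
  rw [this]
  exact hf.isClosed_biUnion fun c _ => isClosed_closedCell

/-- A compact set meets only finitely many open cells. -/
lemma finite_cells_of_isCompact {K : Set T} (hK : IsCompact K) :
    {c : Cells T | (K ∩ openCell c.1 c.2).Nonempty}.Finite := by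
  by_contra hinf
  choose x hxK hxc using fun c : {c : Cells T | (K ∩ openCell c.1 c.2).Nonempty} => c.2
  have hinj : Function.Injective x := fun c c' h =>
    Subtype.ext (eq_of_mem_openCell (hxc c) (h ▸ hxc c'))
  -- With one point chosen in each cell that is met, a closed cell contains only finitely many of
  -- them. So every set of chosen points is closed, and an infinite one could not accumulate in `K`.
  have hcl : ∀ S ⊆ Set.range x, IsClosed S := by
    intro S hS
    refine CWComplex.closed (Set.univ : Set T) S (Set.subset_univ _) |>.2 fun n j => ?_
    refine Set.Finite.isClosed ?_
    obtain ⟨Q, hQ, hQc, hc⟩ := exists_finite_isClosedUnder_cell (⟨n, j⟩ : Cells T)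
    refine ((hQ.preimage Subtype.val_injective.injOn).image x).subset ?_
    rintro y ⟨hyS, hy⟩
    obtain ⟨c, rfl⟩ := hS hyS
    obtain ⟨c', hc', hx⟩ := mem_cellUnion.1 (hQc _ hc hy)
    exact ⟨c, by rw [← eq_of_mem_openCell (hxc c) hx] at hc'; exact hc', rfl⟩
  have hinf' : (Set.range x).Infinite := by
    have := Set.infinite_coe_iff.2 hinf
    exact Set.infinite_range_of_injective hinj
  obtain ⟨z, -, hz⟩ := hinf'.exists_accPt_of_subset_isCompact hK (Set.range_subset_iff.2 hxK)
  have hz' := accPt_iff_frequently.1 hz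
  refine hz' ?_
  filter_upwards [(hcl (Set.range x \ {z}) Set.sdiff_subset).isOpen_compl.mem_nhds
    (fun h => h.2 rfl)] with y hy h
  exact hy ⟨h.2, h.1⟩

/-- A compact set lies in a finite subcomplex. -/
lemma exists_finite_isClosedUnder {K : Set T} (hK : IsCompact K) :
    ∃ Q : Set (Cells T), Q.Finite ∧ IsClosedUnder Q ∧ K ⊆ cellUnion Q := by
  choose Q hQ hQc hc using exists_finite_isClosedUnder_cell (T := T)
  refine ⟨⋃ c ∈ {c : Cells T | (K ∩ openCell c.1 c.2).Nonempty}, Q c,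
    (finite_cells_of_isCompact hK).biUnion fun c _ => hQ c,
    isClosedUnder_biUnion fun c _ => hQc c, fun x hx => ?_⟩
  obtain ⟨c, hxc⟩ := exists_mem_openCell x
  exact mem_cellUnion.2 ⟨c, Set.mem_biUnion (show c ∈ {c : Cells T | _} from ⟨x, hx, hxc⟩) (hc c),
    hxc⟩

lemma openCell_subset_skeleton_of_le {m : ℕ} {c : Cells T} (h : c.1 ≤ m) :
    openCell c.1 c.2 ⊆ (CWComplex.skeleton (Set.univ : Set T) (m : ℕ∞) : Set T) :=
  (openCell_subset_skeleton c.1 c.2).trans (skeleton_mono (by exact_mod_cast h))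

/-- Removing a cell of maximal dimension from a subcomplex leaves a subcomplex. -/
lemma IsClosedUnder.sdiff_singleton {Q : Set (Cells T)} (hQ : IsClosedUnder Q) {c : Cells T}
    (hmax : ∀ c' ∈ Q, c'.1 ≤ c.1) : IsClosedUnder (Q \ {c}) := by
  intro c' hc' x hx
  obtain ⟨c'', hc'', hx''⟩ := mem_cellUnion.1 (hQ c' hc'.1 hx)
  refine mem_cellUnion.2 ⟨c'', ⟨hc'', ?_⟩, hx''⟩
  rintro rfl
  rw [← cellFrontier_union_openCell_eq_closedCell] at hx
  rcases hx with hx | hx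
  -- The frontier of `c'` lies in cells of dimension below that of `c'`, hence below that of the
  -- removed cell.
  · have h1 := cellFrontier_subset_skeletonLT _ _ hx
    exact Set.disjoint_left.1 (disjoint_skeletonLT_openCell (C := (Set.univ : Set T))
      (by exact_mod_cast hmax c' hc'.1)) h1 hx''
  · exact hc'.2 (eq_of_mem_openCell hx hx'')

/-- Cellular approximation: a map of the `m`-cube whose boundary goes to the `m`-skeleton is
homotopic, relative to the boundary, to a map into the `m`-skeleton. -/
theorem exists_homotopicRel_skeleton {m : ℕ} (f : C(Fin m → I, T))
    (hf : ∀ y ∈ Cube.boundary (Fin m),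
      f y ∈ (CWComplex.skeleton (Set.univ : Set T) (m : ℕ∞) : Set T)) :
    ∃ g : C(Fin m → I, T), f.HomotopicRel g (Cube.boundary (Fin m)) ∧
      ∀ y, g y ∈ (CWComplex.skeleton (Set.univ : Set T) (m : ℕ∞) : Set T) := by
  obtain ⟨Q, hQ, hQc, hfQ⟩ := exists_finite_isClosedUnder (isCompact_range f.continuous)
  rw [Set.range_subset_iff] at hfQ
  -- Induction on the number of cells of dimension above `m` in a finite subcomplex containing the
  -- image.
  obtain ⟨N, hN⟩ : ∃ N, {c ∈ Q | m < c.1}.ncard = N := ⟨_, rfl⟩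
  induction N generalizing f Q with
  | zero =>
    rw [Set.ncard_eq_zero (hQ.subset (Set.sep_subset _ _))] at hN
    refine ⟨f, ContinuousMap.HomotopicRel.refl _, fun y => ?_⟩
    obtain ⟨c, hc, hx⟩ := mem_cellUnion.1 (hfQ y)
    refine openCell_subset_skeleton_of_le (not_lt.1 fun h => ?_) hx
    exact Set.eq_empty_iff_forall_notMem.1 hN c ⟨hc, h⟩
  | succ N ih =>
    have hfin : {c ∈ Q | m < c.1}.Finite := hQ.subset (Set.sep_subset _ _)
    have hne : {c ∈ Q | m < c.1}.Nonempty := Set.nonempty_of_ncard_ne_zero (by omega)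
    -- By maximality of the dimension, no closed cell of another member of `Q` meets the open cell
    -- `c`.
    obtain ⟨c, ⟨hcQ, hmc⟩, hcmax⟩ := Set.exists_max_image _ (fun c : Cells T => c.1) hfin hne
    have hmax : ∀ c' ∈ Q, c'.1 ≤ c.1 := fun c' hc' => by
      by_cases h : m < c'.1
      · exact hcmax c' ⟨hc', h⟩
      · omega
    have hQ' := hQc.sdiff_singleton hmax
    have hfin' : (Q \ {c}).Finite := hQ.subset Set.sdiff_subset
    have hdisj : Disjoint (cellUnion (Q \ {c})) (openCell c.1 c.2) := by
      refine Set.disjoint_left.2 fun x hx hxc => ?_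
      obtain ⟨c', hc', hx⟩ := mem_cellUnion.1 hx
      exact hc'.2 (eq_of_mem_openCell hx hxc)
    have hsplit : ∀ x ∈ cellUnion Q, x ∉ openCell c.1 c.2 → x ∈ cellUnion (Q \ {c}) := by
      intro x hx hxc
      obtain ⟨c', hc', hx⟩ := mem_cellUnion.1 hx
      exact mem_cellUnion.2 ⟨c', ⟨hc', by rintro rfl; exact hxc hx⟩, hx⟩
    have hmem : ∀ y, f y ∈ cellUnion (Q \ {c}) ∪ openCell c.1 c.2 := fun y => by
      by_cases h : f y ∈ openCell c.1 c.2
      · exact Or.inr h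
      · exact Or.inl (hsplit _ (hfQ y) h)
    -- The dimension of `c` exceeds `m`, so boundary points of the cube are not mapped to the cell
    -- and stay fixed.
    have hskel : ∀ x ∈ (CWComplex.skeleton (Set.univ : Set T) (m : ℕ∞) : Set T),
        x ∉ openCell c.1 c.2 := fun x hx hxc =>
      Set.disjoint_left.1 (disjoint_skeleton_openCell (C := (Set.univ : Set T))
        (by exact_mod_cast hmc)) hx hxc
    have hsph : ∀ w ∈ Metric.sphere (0 : Fin c.1 → ℝ) 1,
        map (C := (Set.univ : Set T)) c.1 c.2 w ∈ cellUnion (Q \ {c}) := by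
      intro w hw
      have hfr : map (C := (Set.univ : Set T)) c.1 c.2 w ∈ cellFrontier c.1 c.2 := ⟨w, hw, rfl⟩
      refine hsplit _ (hQc c hcQ (cellFrontier_subset_closedCell _ _ hfr)) fun h => ?_
      exact Set.disjoint_left.1 (disjoint_skeletonLT_openCell (C := (Set.univ : Set T)) le_rfl)
        (cellFrontier_subset_skeletonLT _ _ hfr) h
    obtain ⟨g, hfg, hg⟩ := exists_homotopicRel_of_cell hmc
      (source_eq (C := (Set.univ : Set T)) c.1 c.2) (continuousOn c.1 c.2)
      (continuousOn_symm c.1 c.2) (hQ'.isClosed hfin') hsph hdisj f hmem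
      (S := Cube.boundary (Fin m)) (fun y hy => (hmem y).resolve_right (hskel _ (hf y hy)))
    have hgf : ∀ y ∈ Cube.boundary (Fin m), g y = f y := fun y hy => (hfg.some.fst_eq_snd hy).symm
    obtain ⟨g', hg', h⟩ := ih g (fun y hy => hgf y hy ▸ hf y hy) _ hfin' hQ' hg (by
      have : {c' ∈ Q \ {c} | m < c'.1} = {c' ∈ Q | m < c'.1} \ {c} := by
        ext c'; simp only [Set.mem_sdiff, Set.mem_ofPred_eq]; tauto
      rw [this, Set.ncard_sdiff_singleton_of_mem (show c ∈ {c' ∈ Q | m < c'.1} from ⟨hcQ, hmc⟩), hN]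
      rfl)
    exact ⟨g', hfg.trans hg', h⟩

end CellularApproximation

/-! ### The boundary of the fundamental chain of a cube -/

section CubeBoundary

variable {n : ℕ}

lemma faceMap_succAbove (i : Fin (n + 2)) (t : stdSimplex ℝ (Fin (n + 1))) (k : Fin (n + 1)) :
    faceMap i t (i.succAbove k) = t k := by
  change FunOnFinite.linearMap ℝ ℝ i.succAbove t (i.succAbove k) = _
  rw [FunOnFinite.linearMap_apply_apply]
  rw [show (Finset.univ.filter fun j => i.succAbove j = i.succAbove k) = {k} by
    ext j; simp]
  simp

/-- The permutation of `Fin (n + 1)` with `0 ↦ i` and `k + 1 ↦ i.succAbove (q k)`. -/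
def consPerm (i : Fin (n + 1)) (q : Equiv.Perm (Fin n)) : Equiv.Perm (Fin (n + 1)) :=
  i.cycleRange.symm * Equiv.Perm.decomposeFin.symm (0, q)

lemma consPerm_zero (i : Fin (n + 1)) (q : Equiv.Perm (Fin n)) : consPerm i q 0 = i := by
  simp [consPerm]

lemma consPerm_succ (i : Fin (n + 1)) (q : Equiv.Perm (Fin n)) (k : Fin n) :
    consPerm i q k.succ = i.succAbove (q k) := by
  simp [consPerm]

/-- `i.cycleRange` is a cycle of length `i + 1`, and extending `q` by a fixed point keeps its sign.
-/
lemma sign_consPerm (i : Fin (n + 1)) (q : Equiv.Perm (Fin n)) :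
    ((Equiv.Perm.sign (consPerm i q) : ℤˣ) : ℤ) = (-1) ^ (i : ℕ) * (Equiv.Perm.sign q : ℤˣ) := by
  have : Equiv.Perm.sign i.cycleRange.symm = (-1) ^ (i : ℕ) := by
    rw [Equiv.Perm.sign_symm, Fin.sign_cycleRange]
  rw [consPerm, Equiv.Perm.sign_mul, this, Equiv.Perm.decomposeFin.symm_sign]
  simp

/-- Injectivity suffices, because `(n + 1) · n! = (n + 1)!`. -/
lemma consPerm_bijective :
    Function.Bijective fun x : Fin (n + 1) × Equiv.Perm (Fin n) => consPerm x.1 x.2 := by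
  rw [Fintype.bijective_iff_injective_and_card]
  constructor
  · rintro ⟨i, q⟩ ⟨j, r⟩ h
    have h0 := DFunLike.congr_fun h 0
    simp only [consPerm_zero] at h0
    subst h0
    refine Prod.ext rfl (Equiv.ext fun k => ?_)
    have hk := DFunLike.congr_fun h k.succ
    simp only [consPerm_succ] at hk
    exact Fin.succAbove_right_injective hk
  · simp [Fintype.card_perm, Nat.factorial_succ]

/-- The face of the cube where the `i`-th coordinate is `ε`. -/
def cubeFace (i : Fin (n + 1)) (ε : I) : C(Fin n → I, Fin (n + 1) → I) where
  toFun y := i.insertNth ε y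
  continuous_toFun := by fun_prop

lemma cubeFace_same (i : Fin (n + 1)) (ε : I) (y : Fin n → I) : cubeFace i ε y i = ε := by
  simp [cubeFace]

lemma cubeFace_succAbove (i : Fin (n + 1)) (ε : I) (y : Fin n → I) (j : Fin n) :
    cubeFace i ε y (i.succAbove j) = y j := by
  simp [cubeFace]

lemma cubeSimplex_perm_apply (p : Equiv.Perm (Fin n)) (t : stdSimplex ℝ (Fin (n + 1)))
    (a : Fin n) : (cubeSimplex p t (p a) : ℝ) = ∑ k, if a.castSucc < k then t k else 0 := by
  rw [cubeSimplex_apply, Equiv.symm_apply_apply, Finset.sum_filter]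

/-- The first edge of the simplex raises the coordinate `i`, so all vertices but the zeroth have
`i`-th coordinate 1. -/
lemma cubeSimplex_consPerm_face_zero (i : Fin (n + 1)) (q : Equiv.Perm (Fin n))
    (t : stdSimplex ℝ (Fin (n + 1))) :
    cubeSimplex (consPerm i q) (faceMap 0 t) = cubeFace i 1 (cubeSimplex q t) := by
  funext j
  obtain ⟨a, rfl⟩ := (consPerm i q).surjective j
  refine Subtype.ext ?_
  rw [cubeSimplex_perm_apply, Fin.sum_univ_succ]
  induction a using Fin.cases with
  | zero =>
    rw [consPerm_zero, cubeFace_same]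
    have : ∀ k : Fin (n + 1), faceMap 0 t k.succ = t k := fun k => by
      rw [← Fin.succAbove_zero, faceMap_succAbove]
    simp [this]
  | succ b =>
    rw [consPerm_succ, cubeFace_succAbove, cubeSimplex_perm_apply]
    have : ∀ k : Fin (n + 1), faceMap 0 t k.succ = t k := fun k => by
      rw [← Fin.succAbove_zero, faceMap_succAbove]
    simp [this]

/-- After composing with `finRotate`, the coordinate `i` is raised last, so all vertices but the
last have `i`-th coordinate 0. -/
lemma cubeSimplex_consPerm_face_last (i : Fin (n + 1)) (q : Equiv.Perm (Fin n))
    (t : stdSimplex ℝ (Fin (n + 1))) :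
    cubeSimplex (consPerm i q * finRotate (n + 1)) (faceMap (Fin.last _) t) =
      cubeFace i 0 (cubeSimplex q t) := by
  have hface : ∀ k : Fin (n + 1), faceMap (Fin.last _) t k.castSucc = t k := fun k => by
    rw [← Fin.succAbove_last, faceMap_succAbove]
  funext j
  obtain ⟨a, rfl⟩ := (consPerm i q * finRotate (n + 1)).surjective j
  refine Subtype.ext ?_
  rw [cubeSimplex_perm_apply, Fin.sum_univ_castSucc, faceMap_self]
  simp only [hface, ite_self, add_zero]
  induction a using Fin.lastCases with
  | last =>
    rw [Equiv.Perm.mul_apply, finRotate_last, consPerm_zero, cubeFace_same]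
    refine Finset.sum_eq_zero fun k _ => if_neg ?_
    rw [Fin.castSucc_lt_castSucc_iff]
    exact not_lt.2 (Fin.le_last k)
  | cast b =>
    rw [Equiv.Perm.mul_apply, finRotate_apply, Fin.coeSucc_eq_succ, consPerm_succ,
      cubeFace_succAbove, cubeSimplex_perm_apply]
    simp only [Fin.castSucc_lt_castSucc_iff]

variable {X : Type u} [TopologicalSpace X]

lemma sum_consPerm {M : Type*} [AddCommGroup M] (F : Equiv.Perm (Fin (n + 1)) → M) :
    ∑ p, F p = ∑ i : Fin (n + 1), ∑ q : Equiv.Perm (Fin n), F (consPerm i q) := by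
  rw [← Fintype.sum_prod_type']
  exact (Fintype.sum_bijective _ consPerm_bijective _ _ fun _ => rfl).symm

/-- The faces of the simplices of the triangulation of the cube that are not in the boundary of the
cube cancel. -/
lemma sum_inner_face_eq_zero (f : C(Fin (n + 1) → I, X)) (i : Fin n) :
    ∑ p : Equiv.Perm (Fin (n + 1)), ((Equiv.Perm.sign p : ℤˣ) : ℤ) •
      simplexChain ((f.comp (cubeSimplex p)).comp (faceMap i.succ.castSucc)) = 0 := by
  -- Two simplices whose orders differ by an adjacent transposition share the inner face and have
  -- opposite signs.
  refine Finset.sum_involution (fun p _ => p * Equiv.swap i.castSucc i.succ) ?_ ?_ ?_ ?_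
  · intro p _
    have h : (f.comp (cubeSimplex (p * Equiv.swap i.castSucc i.succ))).comp
        (faceMap i.succ.castSucc) = (f.comp (cubeSimplex p)).comp (faceMap i.succ.castSucc) :=
      ContinuousMap.ext fun t => congrArg f (cubeSimplex_swap p i t)
    rw [h, Equiv.Perm.sign_mul, Equiv.Perm.sign_swap (Fin.castSucc_lt_succ).ne]
    simp
  · intro p _ _ h
    have h2 : Equiv.swap i.castSucc i.succ = 1 := mul_eq_left.1 h
    exact (Fin.castSucc_lt_succ (i := i)).ne (Equiv.swap_eq_one_iff.1 h2)
  · intro p _; exact Finset.mem_univ _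
  · intro p _; rw [mul_assoc, Equiv.swap_mul_self, mul_one]

/-- The boundary of the fundamental chain of a cube is the alternating sum of its faces. -/
theorem d_cubeChain (f : C(Fin (n + 1) → I, X)) :
    ((singularChains X).d (n + 1) n).hom (cubeChain f) =
      ∑ i : Fin (n + 1), (-1 : ℤ) ^ (i : ℕ) •
        (cubeChain (f.comp (cubeFace i 1)) - cubeChain (f.comp (cubeFace i 0))) := by
  have hd : ((singularChains X).d (n + 1) n).hom (cubeChain f) =
      ∑ j : Fin (n + 2), (-1 : ℤ) ^ (j : ℕ) • ∑ p : Equiv.Perm (Fin (n + 1)),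
        ((Equiv.Perm.sign p : ℤˣ) : ℤ) •
          simplexChain ((f.comp (cubeSimplex p)).comp (faceMap j)) := by
    rw [cubeChain, map_sum]
    simp only [map_zsmul, d_simplexChain, Finset.smul_sum]
    rw [Finset.sum_comm]
    exact Finset.sum_congr rfl fun j _ => Finset.sum_congr rfl fun p _ => smul_comm _ _ _
  have hzero : ∑ p : Equiv.Perm (Fin (n + 1)), ((Equiv.Perm.sign p : ℤˣ) : ℤ) •
      simplexChain ((f.comp (cubeSimplex p)).comp (faceMap 0)) =
      ∑ i : Fin (n + 1), (-1 : ℤ) ^ (i : ℕ) • cubeChain (f.comp (cubeFace i 1)) := by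
    rw [sum_consPerm]
    refine Finset.sum_congr rfl fun i _ => ?_
    rw [cubeChain, Finset.smul_sum]
    refine Finset.sum_congr rfl fun q _ => ?_
    rw [smul_smul, sign_consPerm]
    congr 2
    exact ContinuousMap.ext fun t => congrArg f (cubeSimplex_consPerm_face_zero i q t)
  have hlast : ∑ p : Equiv.Perm (Fin (n + 1)), ((Equiv.Perm.sign p : ℤˣ) : ℤ) •
      simplexChain ((f.comp (cubeSimplex p)).comp (faceMap (Fin.last _))) =
      (-1 : ℤ) ^ n • ∑ i : Fin (n + 1), (-1 : ℤ) ^ (i : ℕ) •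
        cubeChain (f.comp (cubeFace i 0)) := by
    rw [← Equiv.sum_comp (Equiv.mulRight (finRotate (n + 1))), sum_consPerm, Finset.smul_sum]
    refine Finset.sum_congr rfl fun i _ => ?_
    rw [cubeChain, Finset.smul_sum, Finset.smul_sum]
    refine Finset.sum_congr rfl fun q _ => ?_
    rw [smul_smul, smul_smul, Equiv.coe_mulRight, Equiv.Perm.sign_mul, sign_finRotate,
      Units.val_mul, sign_consPerm]
    congr 1
    · simp [mul_comm, mul_assoc]
    · congr 1
      exact ContinuousMap.ext fun t => congrArg f (cubeSimplex_consPerm_face_last i q t)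
  -- Only the faces opposite the first and the last vertex survive. The latter carries `(-1)ⁿ⁺¹`
  -- from the boundary and `(-1)ⁿ` from the sign of `finRotate`, in total `-1`.
  rw [hd, Fin.sum_univ_succ, Fin.sum_univ_castSucc]
  simp only [Fin.succ_castSucc, sum_inner_face_eq_zero, smul_zero, Finset.sum_const_zero, zero_add,
    Fin.succ_last, hlast, hzero, smul_sub, Finset.sum_sub_distrib]
  rw [smul_smul, ← pow_add, sub_eq_add_neg]
  have : (-1 : ℤ) ^ ((Fin.last (n + 1) : Fin (n + 2)) + n : ℕ) = -1 := by
    rw [Fin.val_last]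
    exact Odd.neg_one_pow ⟨n, by ring⟩
  rw [this]
  simp

lemma cubeChain_mem_chainsIn {A : Set X} (f : C(Fin n → I, X)) (hf : ∀ y, f y ∈ A) :
    cubeChain f ∈ chainsIn A n :=
  sum_mem fun _ _ => zsmul_mem (simplexChain_mem _ fun _ => hf _) _

/-- Modulo chains in `A`, the faces of a cube that lie in `A` do not contribute to its boundary. -/
lemma d_cubeChain_sub_mem {A : Set X} (f : C(Fin (n + 1) → I, X)) (S : Finset (Fin (n + 1)))
    (hS : ∀ i ∉ S, ∀ y : Fin (n + 1) → I, (y i = 0 ∨ y i = 1) → f y ∈ A) :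
    ((singularChains X).d (n + 1) n).hom (cubeChain f) - ∑ i ∈ S, (-1 : ℤ) ^ (i : ℕ) •
      (cubeChain (f.comp (cubeFace i 1)) - cubeChain (f.comp (cubeFace i 0))) ∈
        chainsIn A n := by
  rw [d_cubeChain, ← Finset.sum_add_sum_compl S, add_sub_cancel_left]
  refine sum_mem fun i hi => zsmul_mem (sub_mem ?_ ?_) _
  · exact cubeChain_mem_chainsIn _ fun y =>
      hS i (Finset.mem_compl.1 hi) _ (Or.inr (cubeFace_same i 1 y))
  · exact cubeChain_mem_chainsIn _ fun y =>
      hS i (Finset.mem_compl.1 hi) _ (Or.inl (cubeFace_same i 0 y))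

/-! ### Additivity of the class of a cube -/

/-- The map of cubes that applies `ψ` to the `i`-th coordinate. -/
def cubeUpdate (i : Fin n) (ψ : C(I, I)) : C(Fin n → I, Fin n → I) where
  toFun y := Function.update y i (ψ (y i))
  continuous_toFun := by fun_prop

/-- The map `Iⁿ⁺² → Iⁿ⁺¹` that applies `φ` to the coordinates `i` and `i + 1`. -/
def cubeMerge (i : Fin (n + 1)) (φ : C(I × I, I)) : C(Fin (n + 2) → I, Fin (n + 1) → I) where
  toFun y := Function.update (fun j => y (i.castSucc.succAbove j)) i (φ (y i.castSucc, y i.succ))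
  continuous_toFun := by fun_prop

/-- With `cubeMerge_face_succ`, this says that the four faces in the two merged directions are
reparametrizations along the four sides of the square. -/
lemma cubeMerge_face_castSucc (i : Fin (n + 1)) (φ : C(I × I, I)) (ε : I) :
    (cubeMerge i φ).comp (cubeFace i.castSucc ε) =
      cubeUpdate i (φ.comp ⟨fun s => (ε, s), by fun_prop⟩) := by
  ext1 y
  have h : cubeFace i.castSucc ε y i.succ = y i := by
    conv_lhs => rw [← Fin.succAbove_castSucc_self, cubeFace_succAbove]
  simp only [ContinuousMap.comp_apply, cubeMerge, cubeUpdate, ContinuousMap.coe_mk,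
    cubeFace_succAbove, cubeFace_same, h]

lemma cubeMerge_face_succ (i : Fin (n + 1)) (φ : C(I × I, I)) (ε : I) :
    (cubeMerge i φ).comp (cubeFace i.succ ε) =
      cubeUpdate i (φ.comp ⟨fun t => (t, ε), by fun_prop⟩) := by
  ext1 y
  have h : cubeFace i.succ ε y i.castSucc = y i := by
    conv_lhs => rw [← Fin.succAbove_succ_self, cubeFace_succAbove]
  simp only [ContinuousMap.comp_apply, cubeMerge, cubeUpdate, ContinuousMap.coe_mk,
    cubeFace_same, h]
  funext j
  by_cases hj : j = i
  · subst hj; simp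
  · rw [Function.update_of_ne hj, Function.update_of_ne hj]
    have : i.castSucc.succAbove j = i.succ.succAbove j := by
      rcases lt_or_gt_of_ne hj with hj | hj
      · rw [Fin.succAbove_of_castSucc_lt _ _ (by simpa using hj),
          Fin.succAbove_of_castSucc_lt _ _ (by
            simp only [Fin.lt_def, Fin.val_castSucc, Fin.val_succ] at *; omega)]
      · rw [Fin.succAbove_of_le_castSucc _ _ (by simpa using hj.le),
          Fin.succAbove_of_le_castSucc _ _ (by
            simp only [Fin.lt_def, Fin.le_def, Fin.val_castSucc, Fin.val_succ] at *; omega)]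
    rw [this, cubeFace_succAbove]

/-- The relation between the four sides of a square of reparametrizations of the `i`-th coordinate
of a cube. -/
lemma square_mem_relBoundaries {B A : Set X} (G : C(Fin (n + 1) → I, X)) (i : Fin (n + 1))
    (φ : C(I × I, I)) (hB : ∀ y, G y ∈ B)
    (hA : ∀ y, ∀ j ≠ i, (y j = 0 ∨ y j = 1) → G y ∈ A) :
    (cubeChain (G.comp (cubeUpdate i (φ.comp ⟨fun s => (1, s), by fun_prop⟩))) -
      cubeChain (G.comp (cubeUpdate i (φ.comp ⟨fun s => (0, s), by fun_prop⟩)))) -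
    (cubeChain (G.comp (cubeUpdate i (φ.comp ⟨fun t => (t, 1), by fun_prop⟩))) -
      cubeChain (G.comp (cubeUpdate i (φ.comp ⟨fun t => (t, 0), by fun_prop⟩)))) ∈
      relBoundaries (chainsIn B) (chainsIn A) (n + 1) := by
  -- Only the two merged directions contribute modulo `A`; they are adjacent, so their signs are
  -- opposite.
  have h := d_cubeChain_sub_mem (A := A) (G.comp (cubeMerge i φ)) {i.castSucc, i.succ} (by
    intro l hl y hy
    simp only [Finset.mem_insert, Finset.mem_singleton, not_or] at hl
    obtain ⟨j, rfl⟩ := Fin.exists_succAbove_eq hl.1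
    have hj : j ≠ i := by
      rintro rfl
      exact hl.2 (Fin.succAbove_castSucc_self _)
    refine hA _ j hj ?_
    simpa [cubeMerge, Function.update_of_ne hj] using hy)
  rw [Finset.sum_pair (Fin.castSucc_lt_succ).ne] at h
  simp only [ContinuousMap.comp_assoc, cubeMerge_face_castSucc, cubeMerge_face_succ, Fin.val_succ,
    Fin.val_castSucc, pow_succ, mul_neg, mul_one, neg_smul] at h
  rw [← sub_eq_add_neg, ← smul_sub] at h
  have hc := cubeChain_mem_chainsIn (A := B) (G.comp (cubeMerge i φ)) fun y => hB _
  have key : ∀ (e : ℤ), e * e = 1 → ∀ {M : Type u} [AddCommGroup M] (x y : M),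
      x = e • y + -(e • (y - e • x)) := by
    intro e he M _ x y
    rw [smul_sub, smul_smul, he, one_smul]; abel
  have he : ((-1 : ℤ) ^ (i : ℕ)) * (-1) ^ (i : ℕ) = 1 := by
    rw [← mul_pow]; simp
  rw [key _ he (_ - _ - _) (((singularChains X).d (n + 2) (n + 1)).hom
    (cubeChain (G.comp (cubeMerge i φ)))), ← map_zsmul]
  exact mem_relBoundaries.2 ⟨_, zsmul_mem hc _, _, neg_mem (zsmul_mem h _), rfl⟩

lemma pairHomology_mk_eq_zero {K : ChainComplex AddCommGrpCat.{u} ℕ}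
    {B A : ∀ n, AddSubgroup (K.X n)} {n : ℕ} {c : relCycles B A n} :
    (QuotientAddGroup.mk c : PairHomology B A n) = 0 ↔ (c : K.X n) ∈ relBoundaries B A n := by
  rw [QuotientAddGroup.eq_zero_iff, AddSubgroup.mem_addSubgroupOf]

/-- A cube in `A` has trivial class. -/
lemma cubeClass_eq_zero {B A : Set X} (f : C(Fin n → I, X)) (hB : ∀ y, f y ∈ B)
    (hA : ∀ y, f y ∈ A) : cubeClass f hB (fun y _ => hA y) = 0 :=
  pairHomology_mk_eq_zero.2
    (mem_relBoundaries.2 ⟨0, zero_mem _, _, cubeChain_mem_chainsIn f hA, by simp⟩)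

/-- If `h` is the concatenation of `f` and `g` along the `i`-th coordinate, the class of `h` is the
sum of the classes of `f` and `g`. -/
theorem cubeClass_add {B A : Set X} {f g h : C(Fin (n + 1) → I, X)} (i : Fin (n + 1))
    (hf : ∀ y z : Fin (n + 1) → I, (z i : ℝ) = y i / 2 → (∀ j ≠ i, z j = y j) → h z = f y)
    (hg : ∀ y z : Fin (n + 1) → I, (z i : ℝ) = (1 + y i) / 2 → (∀ j ≠ i, z j = y j) → h z = g y)
    (fB : ∀ y, f y ∈ B) (gB : ∀ y, g y ∈ B) (hB : ∀ y, h y ∈ B)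
    (fA : ∀ y ∈ Cube.boundary (Fin (n + 1)), f y ∈ A)
    (gA : ∀ y ∈ Cube.boundary (Fin (n + 1)), g y ∈ A)
    (hA : ∀ y ∈ Cube.boundary (Fin (n + 1)), h y ∈ A) :
    cubeClass h hB hA = cubeClass f fB fA + cubeClass g gB gA := by
  -- `φ (t, s) = t + (1 - t) s / 2` has sides `φ (0, s) = s / 2`, giving `f`; `φ (t, 1) = (1 + t) /
  -- 2`, giving `g`; `φ (t, 0) = t`, giving `h`; and `φ (1, s) = 1`, giving a cube in `A`.
  let φ : C(I × I, I) := ⟨fun x => ⟨x.1 + (1 - x.1) * x.2 / 2, by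
    have h1 := x.1.2; have h2 := x.2.2
    have : 0 ≤ (1 - x.1 : ℝ) * x.2 := mul_nonneg (by linarith [h1.2]) h2.1
    have : 0 ≤ (1 - x.1 : ℝ) * (1 - x.2) := mul_nonneg (by linarith [h1.2]) (by linarith [h2.2])
    constructor <;> nlinarith [h1.1, h1.2]⟩, by fun_prop⟩
  have key := square_mem_relBoundaries (B := B) (A := A) h i φ hB fun y j _ hj => hA y ⟨j, hj⟩
  have e0 : h.comp (cubeUpdate i (φ.comp ⟨fun s => (0, s), by fun_prop⟩)) = f :=
    ContinuousMap.ext fun y => hf y _ (by simp [cubeUpdate, φ])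
      fun j hj => by simp [cubeUpdate, hj]
  have e1 : h.comp (cubeUpdate i (φ.comp ⟨fun t => (t, 1), by fun_prop⟩)) = g :=
    ContinuousMap.ext fun y => hg y _ (by simp [cubeUpdate, φ]; ring)
      fun j hj => by simp [cubeUpdate, hj]
  have e2 : h.comp (cubeUpdate i (φ.comp ⟨fun t => (t, 0), by fun_prop⟩)) = h :=
    ContinuousMap.ext fun y => congrArg h (by simp [cubeUpdate, φ])
  have e3 : cubeChain (h.comp (cubeUpdate i (φ.comp ⟨fun s => (1, s), by fun_prop⟩))) ∈
      chainsIn A (n + 1) :=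
    cubeChain_mem_chainsIn _ fun y => hA _ ⟨i, Or.inr (Subtype.ext (by simp [cubeUpdate, φ]))⟩
  rw [e0, e1, e2] at key
  rw [← sub_eq_zero]
  refine pairHomology_mk_eq_zero.2 ?_
  have := sub_mem key (mem_relBoundaries.2 ⟨0, zero_mem _, _, e3, by rw [map_zero, zero_add]⟩)
  convert this using 1
  change cubeChain h - (cubeChain f + cubeChain g) = _
  abel

/-- Reversing the `i`-th coordinate changes the sign of the class of a cube. -/
theorem cubeClass_reverse {B A : Set X} {f h : C(Fin (n + 1) → I, X)} (i : Fin (n + 1))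
    (hf : ∀ y z : Fin (n + 1) → I, (z i : ℝ) = 1 - y i → (∀ j ≠ i, z j = y j) → h z = f y)
    (fB : ∀ y, f y ∈ B) (hB : ∀ y, h y ∈ B)
    (fA : ∀ y ∈ Cube.boundary (Fin (n + 1)), f y ∈ A)
    (hA : ∀ y ∈ Cube.boundary (Fin (n + 1)), h y ∈ A) :
    cubeClass f fB fA = - cubeClass h hB hA := by
  -- `φ (t, s) = s (1 - t)`: the sides `t = 0` and `s = 1` give `h` and its reversal `f`, and the
  -- other two are constantly 0, hence give cubes in `A`.
  let φ : C(I × I, I) := ⟨fun x => x.2 * σ x.1, by fun_prop⟩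
  have key := square_mem_relBoundaries (B := B) (A := A) h i φ hB fun y j _ hj => hA y ⟨j, hj⟩
  have e0 : h.comp (cubeUpdate i (φ.comp ⟨fun s => (0, s), by fun_prop⟩)) = h :=
    ContinuousMap.ext fun y => congrArg h (by simp [cubeUpdate, φ])
  have e1 : h.comp (cubeUpdate i (φ.comp ⟨fun t => (t, 1), by fun_prop⟩)) = f :=
    ContinuousMap.ext fun y => hf y _ (by simp [cubeUpdate, φ])
      fun j hj => by simp [cubeUpdate, hj]
  have e2 : cubeChain (h.comp (cubeUpdate i (φ.comp ⟨fun t => (t, 0), by fun_prop⟩))) ∈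
      chainsIn A (n + 1) :=
    cubeChain_mem_chainsIn _ fun y => hA _ ⟨i, Or.inl (by simp [cubeUpdate, φ])⟩
  have e3 : cubeChain (h.comp (cubeUpdate i (φ.comp ⟨fun s => (1, s), by fun_prop⟩))) ∈
      chainsIn A (n + 1) :=
    cubeChain_mem_chainsIn _ fun y => hA _ ⟨i, Or.inl (by simp [cubeUpdate, φ])⟩
  rw [e0, e1] at key
  rw [← sub_eq_zero, sub_neg_eq_add]
  refine pairHomology_mk_eq_zero.2 ?_
  have := sub_mem (mem_relBoundaries.2
    ⟨0, zero_mem _, _, add_mem e2 e3, by rw [map_zero, zero_add]⟩) key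
  convert this using 1
  change cubeChain f + cubeChain h = _
  abel

/-- If the sides of `F` lie in `A`, then up to sign the boundary of `F` is the difference between
its top and its bottom, modulo chains in `A`. -/
lemma d_cubeChain_homotopy_mem {A : Set X} (F : C(Fin (n + 1) → I, X))
    (hFA : ∀ y, ∀ j : Fin n, (y j.castSucc = 0 ∨ y j.castSucc = 1) → F y ∈ A) :
    cubeChain (F.comp (cubeFace (Fin.last n) 1)) - cubeChain (F.comp (cubeFace (Fin.last n) 0)) -
      (-1 : ℤ) ^ n • ((singularChains X).d (n + 1) n).hom (cubeChain F) ∈ chainsIn A n := by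
  have h := d_cubeChain_sub_mem (A := A) F {Fin.last n} (by
    intro i hi y hy
    obtain ⟨j, rfl⟩ := Fin.exists_castSucc_eq.2 (Finset.notMem_singleton.1 hi)
    exact hFA y j hy)
  rw [Finset.sum_singleton, Fin.val_last] at h
  have := zsmul_mem h (-(-1 : ℤ) ^ n)
  rw [smul_sub, smul_smul, neg_mul, ← mul_pow] at this
  convert this using 1
  simp only [mul_neg, mul_one, neg_neg, one_pow, neg_smul, one_smul]
  abel

/-- Homotopy invariance: a homotopy along the last coordinate that keeps the boundary in `A` does
not change the class of a cube. -/
theorem cubeClass_eq_of_homotopy {B A : Set X} (F : C(Fin (n + 1) → I, X)) (hF : ∀ y, F y ∈ B)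
    (hFA : ∀ y, ∀ j : Fin n, (y j.castSucc = 0 ∨ y j.castSucc = 1) → F y ∈ A)
    {f f' : C(Fin n → I, X)} (h0 : F.comp (cubeFace (Fin.last n) 0) = f)
    (h1 : F.comp (cubeFace (Fin.last n) 1) = f')
    (fB : ∀ y, f y ∈ B) (fB' : ∀ y, f' y ∈ B)
    (fA : ∀ y ∈ Cube.boundary (Fin n), f y ∈ A) (fA' : ∀ y ∈ Cube.boundary (Fin n), f' y ∈ A) :
    cubeClass f' fB' fA' = cubeClass f fB fA := by
  have h := d_cubeChain_homotopy_mem F hFA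
  rw [h0, h1] at h
  rw [← sub_eq_zero]
  refine pairHomology_mk_eq_zero.2 (mem_relBoundaries.2
    ⟨(-1 : ℤ) ^ n • cubeChain F, zsmul_mem (cubeChain_mem_chainsIn F hF) _, _, h, ?_⟩)
  rw [map_zsmul, add_sub_cancel]
  rfl

end CubeBoundary

/-! ### Concatenation of cubes -/

section Concat

variable {n : ℕ} {X : Type u} [TopologicalSpace X]

lemma continuous_ite_concat (i : Fin n) (f g : C(Fin n → I, X))
    (hfg : ∀ y, f (Function.update y i 1) = g (Function.update y i 0)) :
    Continuous fun t : Fin n → I => if (t i : ℝ) ≤ 1 / 2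
      then f (Function.update t i (Set.projIcc 0 1 zero_le_one (2 * t i)))
      else g (Function.update t i (Set.projIcc 0 1 zero_le_one (2 * t i - 1))) := by
  have hp : Continuous (Set.projIcc (0 : ℝ) 1 zero_le_one) := continuous_projIcc
  have h1 : Continuous fun t : Fin n → I => (t i : ℝ) :=
    continuous_subtype_val.comp (continuous_apply i)
  refine Continuous.if_le (f.continuous.comp (continuous_id.update i (hp.comp (by fun_prop))))
    (g.continuous.comp (continuous_id.update i (hp.comp (by fun_prop)))) h1 continuous_const
    fun t ht => ?_
  have e1 : Set.projIcc (0 : ℝ) 1 zero_le_one (2 * t i) = 1 :=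
    Set.projIcc_of_right_le _ (by rw [ht]; norm_num)
  have e0 : Set.projIcc (0 : ℝ) 1 zero_le_one (2 * t i - 1) = 0 :=
    Set.projIcc_of_le_left _ (by rw [ht]; norm_num)
  rw [e1, e0]
  exact hfg t

/-- The concatenation of `f` and `g` along the `i`-th coordinate. -/
def cubeConcat (i : Fin n) (f g : C(Fin n → I, X))
    (hfg : ∀ y, f (Function.update y i 1) = g (Function.update y i 0)) : C(Fin n → I, X) :=
  ⟨_, continuous_ite_concat i f g hfg⟩

variable {i : Fin n} {f g : C(Fin n → I, X)}
  {hfg : ∀ y, f (Function.update y i 1) = g (Function.update y i 0)}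

lemma cubeConcat_apply (t : Fin n → I) : cubeConcat i f g hfg t = if (t i : ℝ) ≤ 1 / 2
      then f (Function.update t i (Set.projIcc 0 1 zero_le_one (2 * t i)))
      else g (Function.update t i (Set.projIcc 0 1 zero_le_one (2 * t i - 1))) :=
  rfl

lemma update_eq_of_eq {y z : Fin n → I} {a : I} (ha : a = y i) (h : ∀ j ≠ i, z j = y j) :
    Function.update z i a = y := by
  funext j
  by_cases hj : j = i
  · subst hj; simpa using ha
  · simpa [hj] using h j hj

lemma cubeConcat_left {y z : Fin n → I} (hz : (z i : ℝ) = y i / 2) (h : ∀ j ≠ i, z j = y j) :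
    cubeConcat i f g hfg z = f y := by
  rw [cubeConcat_apply, if_pos (by rw [hz]; linarith [(y i).2.2])]
  congr 1
  refine update_eq_of_eq ?_ h
  rw [hz, mul_div_cancel₀ _ two_ne_zero, Set.projIcc_val]

lemma cubeConcat_right {y z : Fin n → I} (hz : (z i : ℝ) = (1 + y i) / 2)
    (h : ∀ j ≠ i, z j = y j) : cubeConcat i f g hfg z = g y := by
  rw [cubeConcat_apply]
  split_ifs with hle
  -- The midpoint falls into the branch of `f`, and the matching condition `hfg` carries it over to
  -- `g`.
  · have h0 : y i = 0 := by
      refine Subtype.ext (le_antisymm ?_ (y i).2.1)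
      change (y i : ℝ) ≤ 0
      linarith
    have e1 : Set.projIcc (0 : ℝ) 1 zero_le_one (2 * z i) = 1 :=
      Set.projIcc_of_right_le _ (by rw [hz, h0]; norm_num)
    rw [e1, hfg]
    congr 1
    exact update_eq_of_eq h0.symm h
  · congr 1
    refine update_eq_of_eq ?_ h
    rw [hz, mul_div_cancel₀ _ two_ne_zero, add_sub_cancel_left, Set.projIcc_val]

lemma cubeConcat_mem {S : Set X} (hf : ∀ y, f y ∈ S) (hg : ∀ y, g y ∈ S) (y : Fin n → I) :
    cubeConcat i f g hfg y ∈ S := by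
  rw [cubeConcat_apply]
  split_ifs
  exacts [hf _, hg _]

lemma cubeConcat_mem_of_ne {S : Set X} {y : Fin n → I} {j : Fin n} (hj : j ≠ i)
    (hf : ∀ z, z j = y j → f z ∈ S) (hg : ∀ z, z j = y j → g z ∈ S) :
    cubeConcat i f g hfg y ∈ S := by
  rw [cubeConcat_apply]
  split_ifs
  exacts [hf _ (Function.update_of_ne hj _ _), hg _ (Function.update_of_ne hj _ _)]

lemma cubeConcat_of_eq_zero {y : Fin n → I} (hy : y i = 0) : cubeConcat i f g hfg y = f y :=
  cubeConcat_left (by simp [hy]) fun _ _ => rfl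

lemma cubeConcat_of_eq_one {y : Fin n → I} (hy : y i = 1) : cubeConcat i f g hfg y = g y :=
  cubeConcat_right (by simp [hy]) fun _ _ => rfl

end Concat

/-! ### Cellular homotopies as cubes -/

section CellularHomotopies

open PointedCWComplex

variable {T : Type u} [TopologicalSpace T] [T2Space T] [PointedCWComplex T] {n : ℕ}

lemma cubeFace_last_castSucc (ε : I) (y : Fin n → I) (j : Fin n) :
    cubeFace (Fin.last n) ε y j.castSucc = y j := by
  rw [← Fin.succAbove_last, cubeFace_succAbove]

lemma cubeFace_last_eq {y : Fin (n + 1) → I} {ε : I} (h : y (Fin.last n) = ε) :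
    cubeFace (Fin.last n) ε (fun i => y i.castSucc) = y := by
  funext j
  induction j using Fin.lastCases with
  | last => rw [cubeFace_same, h]
  | cast j => rw [cubeFace_last_castSucc]

namespace CellularHomotopy

variable {f f' f'' : CellularLoop T n}

/-- A cellular homotopy, as a map of the cube `Iⁿ⁺¹`. -/
def cube (H : CellularHomotopy f f') : C(Fin (n + 1) → I, T) := H.toMap.comp (cubeSplit n)

lemma cube_mem (H : CellularHomotopy f f') (y : Fin (n + 1) → I) : H.cube y ∈ skel T (n + 2) :=
  H.cellular _ _

lemma cube_base (H : CellularHomotopy f f') {y : Fin (n + 1) → I} {j : Fin n}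
    (hj : y j.castSucc = 0 ∨ y j.castSucc = 1) : H.cube y = pt :=
  H.base _ ⟨j, hj⟩ _

lemma cube_zero (H : CellularHomotopy f f') {y : Fin (n + 1) → I} (h : y (Fin.last n) = 0) :
    H.cube y = f.toLoop fun i => y i.castSucc := by
  rw [← H.map_zero, ← h]; rfl

lemma cube_one (H : CellularHomotopy f f') {y : Fin (n + 1) → I} (h : y (Fin.last n) = 1) :
    H.cube y = f'.toLoop fun i => y i.castSucc := by
  rw [← H.map_one, ← h]; rfl

lemma cube_boundary (H : CellularHomotopy f f') (y : Fin (n + 1) → I)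
    (hy : y ∈ Cube.boundary (Fin (n + 1))) : H.cube y ∈ skel T (n + 1) := by
  obtain ⟨j, hj⟩ := hy
  induction j using Fin.lastCases with
  | last =>
    rcases hj with hj | hj
    · rw [H.cube_zero hj]; exact f.cellular _
    · rw [H.cube_one hj]; exact f'.cellular _
  | cast j => rw [H.cube_base hj]; exact pt_mem_skel T _

/-- The cellular homotopy given by a map of the cube `Iⁿ⁺¹`. -/
def ofCube (F : C(Fin (n + 1) → I, T)) (hF : ∀ y, F y ∈ skel T (n + 2))
    (hb : ∀ y, ∀ j : Fin n, (y j.castSucc = 0 ∨ y j.castSucc = 1) → F y = pt)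
    (h0 : ∀ y, y (Fin.last n) = 0 → F y = f.toLoop fun i => y i.castSucc)
    (h1 : ∀ y, y (Fin.last n) = 1 → F y = f'.toLoop fun i => y i.castSucc) :
    CellularHomotopy f f' where
  toMap := F.comp ⟨fun x => (Fin.last n).insertNth (α := fun _ => I) x.2 x.1, by fun_prop⟩
  cellular _ _ := hF _
  base y hy s := by
    obtain ⟨j, hj⟩ := hy
    refine hb (cubeFace (Fin.last n) s y) j ?_
    rwa [cubeFace_last_castSucc]
  map_zero y := by
    refine (h0 (cubeFace (Fin.last n) 0 y) (cubeFace_same _ _ _)).trans (congrArg _ ?_)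
    exact funext fun i => cubeFace_last_castSucc _ _ _
  map_one y := by
    refine (h1 (cubeFace (Fin.last n) 1 y) (cubeFace_same _ _ _)).trans (congrArg _ ?_)
    exact funext fun i => cubeFace_last_castSucc _ _ _

lemma cube_ofCube {F : C(Fin (n + 1) → I, T)} {hF : ∀ y, F y ∈ skel T (n + 2)}
    {hb : ∀ y, ∀ j : Fin n, (y j.castSucc = 0 ∨ y j.castSucc = 1) → F y = pt}
    {h0 : ∀ y, y (Fin.last n) = 0 → F y = f.toLoop fun i => y i.castSucc}
    {h1 : ∀ y, y (Fin.last n) = 1 → F y = f'.toLoop fun i => y i.castSucc} :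
    (ofCube F hF hb h0 h1).cube = F :=
  ContinuousMap.ext fun _ => congrArg F (cubeFace_last_eq rfl)

/-- Rewrites the cube inside `cubeClass`, where membership proofs depend on it. -/
lemma chain_congr (H : CellularHomotopy f f') {F : C(Fin (n + 1) → I, T)} (h : H.cube = F) :
    H.chain = cubeClass F (fun y => h ▸ H.cube_mem y) (fun y hy => h ▸ H.cube_boundary y hy) := by
  subst h; rfl

/-- The constant homotopy. -/
protected def refl (f : CellularLoop T n) : CellularHomotopy f f :=
  ofCube (f.toLoop.1.comp ⟨fun y i => y i.castSucc, by fun_prop⟩)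
    (fun _ => skel_subset_succ T _ (f.cellular _)) (fun y j hj => f.toLoop.2 _ ⟨j, hj⟩)
    (fun _ _ => rfl) fun _ _ => rfl

/-- Such homotopies do not change `ω`; reflexivity and all the group axioms use this. -/
lemma chain_eq_zero (H : CellularHomotopy f f') (h : ∀ y, H.cube y ∈ skel T (n + 1)) :
    H.chain = 0 :=
  cubeClass_eq_zero _ _ h

lemma chain_refl (f : CellularLoop T n) : (CellularHomotopy.refl f).chain = 0 :=
  chain_eq_zero _ fun _ => by
    rw [CellularHomotopy.refl, cube_ofCube]
    exact f.cellular _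

/-- The reversed homotopy. -/
protected def symm (H : CellularHomotopy f f') : CellularHomotopy f' f :=
  ofCube (H.cube.comp (cubeUpdate (Fin.last n) ⟨σ, by fun_prop⟩)) (fun _ => H.cube_mem _)
    (fun y j hj => H.cube_base (j := j) (by simpa [cubeUpdate] using hj))
    (fun y hy => by
      refine (H.cube_one (by simp [cubeUpdate, hy])).trans ?_
      congr 1; funext i; simp [cubeUpdate])
    (fun y hy => by
      refine (H.cube_zero (by simp [cubeUpdate, hy])).trans ?_
      congr 1; funext i; simp [cubeUpdate])

lemma chain_symm (H : CellularHomotopy f f') : H.symm.chain = -H.chain := by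
  rw [chain_congr H.symm cube_ofCube]
  refine cubeClass_reverse (Fin.last n) (fun y z hz h => ?_) _ _ _ _
  refine congrArg H.cube (funext fun j => ?_)
  by_cases hj : j = Fin.last n
  · subst hj
    simpa [cubeUpdate] using Subtype.ext hz
  · simpa [cubeUpdate, hj] using h j hj

lemma trans_aux (H : CellularHomotopy f f') (K : CellularHomotopy f' f'') (y : Fin (n + 1) → I) :
    H.cube (Function.update y (Fin.last n) 1) = K.cube (Function.update y (Fin.last n) 0) := by
  rw [H.cube_one (by simp), K.cube_zero (by simp)]
  congr 1
  funext i
  simp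

/-- The concatenation of two homotopies. -/
protected def trans (H : CellularHomotopy f f') (K : CellularHomotopy f' f'') :
    CellularHomotopy f f'' :=
  ofCube (cubeConcat (Fin.last n) H.cube K.cube (trans_aux H K))
    (cubeConcat_mem H.cube_mem K.cube_mem)
    (fun y j hj => cubeConcat_mem_of_ne (S := {pt}) (j := j.castSucc) (Fin.castSucc_lt_last j).ne
      (fun z hz => H.cube_base (by rwa [hz])) (fun z hz => K.cube_base (by rwa [hz])))
    (fun y hy => (cubeConcat_of_eq_zero hy).trans (H.cube_zero hy))
    (fun y hy => (cubeConcat_of_eq_one hy).trans (K.cube_one hy))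

lemma chain_trans (H : CellularHomotopy f f') (K : CellularHomotopy f' f'') :
    (H.trans K).chain = H.chain + K.chain := by
  rw [chain_congr (H.trans K) cube_ofCube]
  exact cubeClass_add (Fin.last n) (fun y z => cubeConcat_left) (fun y z => cubeConcat_right)
    _ _ _ _ _ _

/-! ### Products of homotopies -/

variable {g g' h h' : CellularLoop T (n + 1)}

lemma mul_aux (H : CellularHomotopy g g') (K : CellularHomotopy h h') (y : Fin (n + 2) → I) :
    H.cube (Function.update y (Fin.last n).castSucc 1) =
      K.cube (Function.update y (Fin.last n).castSucc 0) := by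
  rw [H.cube_base (j := Fin.last n) (by simp), K.cube_base (j := Fin.last n) (by simp)]

lemma mul_apply (f g : CellularLoop T (n + 1)) (t : Fin (n + 1) → I) :
    (f.mul g).toLoop t = if (t (Fin.last n) : ℝ) ≤ 1 / 2
      then f.toLoop
        (Function.update t (Fin.last n) (Set.projIcc 0 1 zero_le_one (2 * t (Fin.last n))))
      else g.toLoop
        (Function.update t (Fin.last n) (Set.projIcc 0 1 zero_le_one (2 * t (Fin.last n) - 1))) :=
  rfl

lemma update_castSucc (y : Fin (n + 2) → I) (a : I) :
    (fun i : Fin (n + 1) => Function.update y (Fin.last n).castSucc a i.castSucc) =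
      Function.update (fun i : Fin (n + 1) => y i.castSucc) (Fin.last n) a :=
  Function.update_comp_eq_of_injective y (Fin.castSucc_injective _) _ _

/-- The product of two homotopies. -/
protected def mul (H : CellularHomotopy g g') (K : CellularHomotopy h h') :
    CellularHomotopy (g.mul h) (g'.mul h') :=
  ofCube (cubeConcat (Fin.last n).castSucc H.cube K.cube (mul_aux H K))
    (cubeConcat_mem H.cube_mem K.cube_mem)
    (fun y j hj => by
      by_cases hjn : j = Fin.last n
      · subst hjn
        rcases hj with hj | hj
        · exact (cubeConcat_of_eq_zero hj).trans (H.cube_base (Or.inl hj))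
        · exact (cubeConcat_of_eq_one hj).trans (K.cube_base (Or.inr hj))
      · exact cubeConcat_mem_of_ne (S := {pt}) (j := j.castSucc)
          (fun h => hjn (Fin.castSucc_injective _ h))
          (fun z hz => H.cube_base (by rwa [hz])) (fun z hz => K.cube_base (by rwa [hz])))
    (fun y hy => by
      -- The last coordinate is the homotopy parameter; the loops are concatenated along the one
      -- before it.
      have hl : Fin.last (n + 1) ≠ (Fin.last n).castSucc := (Fin.castSucc_lt_last _).ne'
      rw [cubeConcat_apply, mul_apply, H.cube_zero (by rw [Function.update_of_ne hl, hy]),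
        K.cube_zero (by rw [Function.update_of_ne hl, hy]), update_castSucc, update_castSucc])
    (fun y hy => by
      have hl : Fin.last (n + 1) ≠ (Fin.last n).castSucc := (Fin.castSucc_lt_last _).ne'
      rw [cubeConcat_apply, mul_apply, H.cube_one (by rw [Function.update_of_ne hl, hy]),
        K.cube_one (by rw [Function.update_of_ne hl, hy]), update_castSucc, update_castSucc])

lemma chain_mul (H : CellularHomotopy g g') (K : CellularHomotopy h h') :
    (H.mul K).chain = H.chain + K.chain := by
  rw [chain_congr (H.mul K) cube_ofCube]
  exact cubeClass_add (Fin.last n).castSucc (fun y z => cubeConcat_left)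
    (fun y z => cubeConcat_right) _ _ _ _ _ _

end CellularHomotopy

/-- A homotopy of generalized loops as a map of the cube `Iⁿ⁺¹`. -/
lemma exists_cube_of_homotopic {X : Type u} [TopologicalSpace X] {x : X} {p q : GenLoop (Fin n) X x}
    (h : GenLoop.Homotopic p q) : ∃ F : C(Fin (n + 1) → I, X),
      (∀ y, ∀ j : Fin n, (y j.castSucc = 0 ∨ y j.castSucc = 1) → F y = x) ∧
      (∀ y, y (Fin.last n) = 0 → F y = p fun i => y i.castSucc) ∧
      ∀ y, y (Fin.last n) = 1 → F y = q fun i => y i.castSucc := by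
  obtain ⟨H⟩ := h
  refine ⟨H.toContinuousMap.comp ⟨fun y => (y (Fin.last n), fun i => y i.castSucc), by fun_prop⟩,
    fun y j hj => ?_, fun y hy => ?_, fun y hy => ?_⟩
  · exact (H.eq_fst _ (show (fun i : Fin n => y i.castSucc) ∈ _ from ⟨j, hj⟩)).trans
      (p.2 _ ⟨j, hj⟩)
  · change H (y (Fin.last n), _) = _
    rw [hy]; exact H.apply_zero _
  · change H (y (Fin.last n), _) = _
    rw [hy]; exact H.apply_one _

/-- Homotopic cellular loops are cellularly homotopic. -/
lemma exists_cellularHomotopy {f f' : CellularLoop T n}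
    (h : GenLoop.Homotopic f.toLoop f'.toLoop) : Nonempty (CellularHomotopy f f') := by
  obtain ⟨F, hb, h0, h1⟩ := exists_cube_of_homotopic h
  obtain ⟨G, hFG, hG⟩ := exists_homotopicRel_skeleton F fun y hy => by
    change F y ∈ skel T (n + 2)
    obtain ⟨j, hj⟩ := hy
    induction j using Fin.lastCases with
    | last =>
      rcases hj with hj | hj
      · rw [h0 y hj]; exact skel_subset_succ T _ (f.cellular _)
      · rw [h1 y hj]; exact skel_subset_succ T _ (f'.cellular _)
    | cast j => rw [hb y j hj]; exact pt_mem_skel T _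
  have e : ∀ y, ∀ j, (y j = 0 ∨ y j = 1) → G y = F y := fun y j hj =>
    (hFG.some.fst_eq_snd ⟨j, hj⟩).symm
  exact ⟨CellularHomotopy.ofCube G hG (fun y j hj => (e y _ hj).trans (hb y j hj))
    (fun y hy => (e y _ (Or.inl hy)).trans (h0 y hy))
    (fun y hy => (e y _ (Or.inr hy)).trans (h1 y hy))⟩

/-- Every loop is homotopic to a cellular one. -/
lemma exists_cellularLoop (f : GenLoop (Fin n) T pt) :
    ∃ f' : CellularLoop T n, GenLoop.Homotopic f f'.toLoop := by
  obtain ⟨g, hfg, hg⟩ := exists_homotopicRel_skeleton f.1 fun y hy => by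
    change f.1 y ∈ skel T (n + 1)
    rw [f.2 y hy]; exact pt_mem_skel T _
  exact ⟨⟨⟨g, fun y hy => (hfg.some.fst_eq_snd hy).symm.trans (f.2 y hy)⟩, hg⟩, hfg⟩

lemma piMk_eq_iff {f g : GenLoop (Fin n) T pt} : piMk f = piMk g ↔ GenLoop.Homotopic f g :=
  Quotient.eq (r := GenLoop.Homotopic.setoid (Fin n) (pt : T))

lemma exists_piMk_cellular (α : π_ n T pt) : ∃ f : CellularLoop T n, piMk f.toLoop = α := by
  obtain ⟨f, rfl⟩ := Quotient.exists_rep α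
  obtain ⟨f', h⟩ := exists_cellularLoop f
  exact ⟨f', (piMk_eq_iff.2 h).symm⟩

/-- The order is reversed: in `π_`, the right factor is traversed first. -/
lemma piMk_mul (f g : GenLoop (Fin (n + 1)) T pt) :
    piMk (GenLoop.transAt (Fin.last n) f g) = piMk g * piMk f :=
  (HomotopyGroup.mul_spec (i := Fin.last n)).symm

end CellularHomotopies

open PointedCWComplex

variable {T : Type u} [TopologicalSpace T] [T2Space T] [PointedCWComplex T] {n : ℕ}

/-! ### The Hurewicz homomorphism -/

section Hurewicz

lemma CellularHomotopy.cube_comp_face_zero {f f' : CellularLoop T n} (H : CellularHomotopy f f') :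
    H.cube.comp (cubeFace (Fin.last n) 0) = f.toLoop.1 :=
  ContinuousMap.ext fun _ => (H.cube_zero (cubeFace_same _ _ _)).trans
    (congrArg f.toLoop (funext fun _ => cubeFace_last_castSucc _ _ _))

lemma CellularHomotopy.cube_comp_face_one {f f' : CellularLoop T n} (H : CellularHomotopy f f') :
    H.cube.comp (cubeFace (Fin.last n) 1) = f'.toLoop.1 :=
  ContinuousMap.ext fun _ => (H.cube_one (cubeFace_same _ _ _)).trans
    (congrArg f'.toLoop (funext fun _ => cubeFace_last_castSucc _ _ _))

/-- The class `f_*([Sⁿ]) ∈ Cₙ(T)` of a cellular loop. -/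
def CellularLoop.cellularClass (f : CellularLoop T n) : CellularChains T n :=
  relIncl n subset_rfl (Set.singleton_subset_iff.2 (pt_mem_skel T _)) f.class

/-- The classes of homotopic cellular loops differ by a boundary. -/
lemma CellularHomotopy.cellularD_chain {f f' : CellularLoop T n} (H : CellularHomotopy f f') :
    cellularD T n ((-1 : ℤ) ^ n • H.chain) = f'.cellularClass - f.cellularClass := by
  have h := d_cubeChain_homotopy_mem (A := {pt}) H.cube fun y j hj => H.cube_base hj
  rw [H.cube_comp_face_zero, H.cube_comp_face_one] at h
  rw [← sub_eq_zero, ← neg_eq_zero, neg_sub, map_zsmul]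
  -- No bounding chain is needed: the sides of the homotopy are constant, so the error consists of
  -- chains at the base point.
  refine pairHomology_mk_eq_zero.2 (mem_relBoundaries.2 ⟨0, zero_mem _, _,
    chainsIn_mono (Set.singleton_subset_iff.2 (pt_mem_skel T _)) _ h,
    (congrArg (· + _) (_root_.map_zero _)).trans (zero_add _)⟩)

/-- A homotopy can be taken cellular, and then its chain bounds the difference of the two classes.
-/
lemma skelToCellular_eq_of_homotopic {f f' : CellularLoop T (n + 1)}
    (h : GenLoop.Homotopic f.toLoop f'.toLoop) :
    skelToCellular n f.class = skelToCellular n f'.class := by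
  obtain ⟨H⟩ := exists_cellularHomotopy h
  refine Eq.symm (QuotientAddGroup.eq_iff_sub_mem.2 ?_)
  rw [AddSubgroup.mem_addSubgroupOf]
  exact ⟨_, H.cellularD_chain⟩

lemma CellularLoop.class_mul (f g : CellularLoop T (n + 1)) :
    (f.mul g).class = f.class + g.class := by
  have hfg : ∀ y, f.toLoop.1 (Function.update y (Fin.last n) 1) =
      g.toLoop.1 (Function.update y (Fin.last n) 0) := fun y =>
    (f.toLoop.2 _ ⟨Fin.last n, by simp⟩).trans (g.toLoop.2 _ ⟨Fin.last n, by simp⟩).symm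
  exact cubeClass_add (Fin.last n)
    (fun y z hz h => cubeConcat_left (hfg := hfg) hz h)
    (fun y z hz h => cubeConcat_right (hfg := hfg) hz h) _ _ _ _ _ _

lemma singularHurewicz_eq_of_homotopic {f g : GenLoop (Fin n) T pt} (h : GenLoop.Homotopic f g) :
    singularHurewicz f = singularHurewicz g := by
  obtain ⟨F, hb, h0, h1⟩ := exists_cube_of_homotopic h
  refine (cubeClass_eq_of_homotopy F (fun _ => Set.mem_univ _) hb
    (ContinuousMap.ext fun y => ?_) (ContinuousMap.ext fun y => ?_) _ _ _ _).symm
  · exact (h0 _ (cubeFace_same _ _ _)).trans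
      (congrArg f (funext fun i => cubeFace_last_castSucc _ _ _))
  · exact (h1 _ (cubeFace_same _ _ _)).trans
      (congrArg g (funext fun i => cubeFace_last_castSucc _ _ _))

/-- A cellular representative of a homotopy class. -/
def cellularRep (α : π_ n T pt) : CellularLoop T n := (exists_piMk_cellular α).choose

lemma piMk_cellularRep (α : π_ n T pt) : piMk (cellularRep α).toLoop = α :=
  (exists_piMk_cellular α).choose_spec

variable (T) in
/-- The Hurewicz homomorphism `πₙ₊₁(T) → Hₙ₊₁(C_*(T))`. -/
def hurewicz (n : ℕ) : π_ (n + 1) T pt →* Multiplicative (CellularHomology T n) :=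
  MonoidHom.mk' (fun α => Multiplicative.ofAdd (skelToCellular n (cellularRep α).class)) (by
    intro α β
    refine (skelToCellular_eq_of_homotopic
      (f' := (cellularRep β).mul (cellularRep α)) (piMk_eq_iff.1 ?_)).trans ?_
    · rw [piMk_cellularRep]
      refine Eq.trans ?_ (piMk_mul _ _).symm
      rw [piMk_cellularRep, piMk_cellularRep]
    · rw [CellularLoop.class_mul, map_add]
      -- The reversed order of the product in `π_` is harmless, as the target is commutative.
      exact add_comm _ _)

lemma hurewicz_piMk (f : CellularLoop T (n + 1)) :
    (hurewicz T n (piMk f.toLoop)).toAdd = skelToCellular n f.class :=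
  skelToCellular_eq_of_homotopic (piMk_eq_iff.1 (piMk_cellularRep _))

/-- The class of a cellular representative in the skeleton is the required lift, since the singular
Hurewicz class is homotopy invariant. -/
lemma isHurewicz_hurewicz : IsHurewicz n fun α : π_ (n + 1) T pt => (hurewicz T n α).toAdd where
  singular f := ⟨(cellularRep (piMk f)).class,
    singularHurewicz_eq_of_homotopic (piMk_eq_iff.1 (piMk_cellularRep _)), rfl⟩
  cellular := hurewicz_piMk

end Hurewicz

/-! ### The exact sequence -/

section Exact

variable {W : ChainComplex AddCommGrpCat.{v} ℤ} (ρ : CellularChainMap T W)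

/-- The map `Cₙ(T) → W̃ₙ` induced by `ρ`. -/
def CellularChainMap.tilde (n : ℕ) : CellularChains T n →+ Wtilde W n :=
  (QuotientAddGroup.mk' _).comp (ρ.app n)

lemma pairHomotopic_iff {p q : CellularLoop T n × Wtilde W (n + 1)} :
    PairHomotopic ρ n p q ↔ ∃ H : CellularHomotopy p.1 q.1,
      q.2 - p.2 = (-1 : ℤ) ^ (n + 1) • ρ.tilde (n + 1) H.chain :=
  Iff.rfl

/-- Constant, reversed and concatenated homotopies have chains that are zero, negated and added. -/
theorem pairHomotopic_equivalence (n : ℕ) : _root_.Equivalence (PairHomotopic ρ n) where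
  refl p := ⟨CellularHomotopy.refl p.1, by
    change _ = (-1 : ℤ) ^ (n + 1) • ρ.tilde (n + 1) _
    rw [CellularHomotopy.chain_refl, map_zero, smul_zero, sub_self]⟩
  symm := by
    rintro p q ⟨H, hH⟩
    refine ⟨H.symm, ?_⟩
    change _ = (-1 : ℤ) ^ (n + 1) • ρ.tilde (n + 1) _ at hH ⊢
    rw [CellularHomotopy.chain_symm, map_neg, smul_neg, ← hH, neg_sub]
  trans := by
    rintro p q r ⟨H, hH⟩ ⟨K, hK⟩
    refine ⟨H.trans K, ?_⟩
    change _ = (-1 : ℤ) ^ (n + 1) • ρ.tilde (n + 1) _ at hH hK ⊢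
    rw [CellularHomotopy.chain_trans, map_add, smul_add, ← hH, ← hK]
    abel

/-- `Quot` imposes the generated equivalence relation; equal classes are joined by one homotopy
because the relation is already an equivalence. -/
lemma PiHat.mk_eq_mk {f g : CellularLoop T n} {ω τ : Wtilde W (n + 1)} :
    PiHat.mk ρ f ω = PiHat.mk ρ g τ ↔ PairHomotopic ρ n (f, ω) (g, τ) :=
  Quot.eq.trans (pairHomotopic_equivalence ρ n).eqvGen_iff

lemma PiHat.ind {P : PiHat ρ n → Prop} (h : ∀ f ω, P (PiHat.mk ρ f ω)) (x : PiHat ρ n) : P x :=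
  Quot.ind (fun p => h p.1 p.2) x

theorem PiHat.zeta_surjective (n : ℕ) : Function.Surjective (PiHat.zeta ρ n) := fun α => by
  obtain ⟨f, rfl⟩ := exists_piMk_cellular α
  exact ⟨PiHat.mk ρ f 0, rfl⟩

theorem PiHat.zeta_eq_iff (x : PiHat ρ n) : PiHat.zeta ρ n x = piMk GenLoop.const ↔
    ∃ ω : Wtilde W (n + 1), PiHat.a ρ n ω = x := by
  constructor
  · induction x using PiHat.ind with
    | h f ω =>
      intro h
      obtain ⟨H⟩ := exists_cellularHomotopy (f := CellularLoop.const n) (f' := f)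
        (piMk_eq_iff.1 h).symm
      -- The second entry from which `H`, starting at the constant loop, arrives at `ω`.
      refine ⟨ω - (-1 : ℤ) ^ (n + 1) • ρ.tilde (n + 1) H.chain, (PiHat.mk_eq_mk ρ).2 ⟨H, ?_⟩⟩
      exact sub_sub_cancel _ _
  · rintro ⟨ω, rfl⟩
    rfl

lemma homologyToTilde_hurewicz (f : CellularLoop T (n + 1)) :
    homologyToTilde W n (ρ.homologyMap n (hurewicz T n (piMk f.toLoop)).toAdd) =
      ρ.tilde (n + 1) f.cellularClass := by
  rw [hurewicz_piMk]
  rfl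

/-- A cellular loop of dimension `n + 1`, as a homotopy between constant loops. -/
def CellularLoop.toHomotopy (f : CellularLoop T (n + 1)) :
    CellularHomotopy (CellularLoop.const n : CellularLoop T n) (CellularLoop.const n) :=
  CellularHomotopy.ofCube f.toLoop.1 f.cellular (fun y _ hj => f.toLoop.2 y ⟨_, hj⟩)
    (fun y hy => f.toLoop.2 y ⟨_, Or.inl hy⟩) (fun y hy => f.toLoop.2 y ⟨_, Or.inr hy⟩)

lemma CellularLoop.chain_toHomotopy (f : CellularLoop T (n + 1)) :
    f.toHomotopy.chain = f.cellularClass :=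
  CellularHomotopy.chain_congr _ CellularHomotopy.cube_ofCube

/-- A homotopy between constant loops, as a cellular loop. -/
def CellularHomotopy.toCellularLoop
    (H : CellularHomotopy (CellularLoop.const n : CellularLoop T n) (CellularLoop.const n)) :
    CellularLoop T (n + 1) where
  toLoop := ⟨H.cube, by
    rintro y ⟨j, hj⟩
    induction j using Fin.lastCases with
    | last => rcases hj with hj | hj
              · rw [H.cube_zero hj]; rfl
              · rw [H.cube_one hj]; rfl
    | cast j => exact H.cube_base hj⟩
  cellular := H.cube_mem

lemma CellularHomotopy.cellularClass_toCellularLoop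
    (H : CellularHomotopy (CellularLoop.const n : CellularLoop T n) (CellularLoop.const n)) :
    H.toCellularLoop.cellularClass = H.chain :=
  rfl

/-- Homotopies between constant loops of dimension `n` are loops of dimension `n + 1`, with the same
chain. -/
theorem PiHat.a_eq_iff (ω : Wtilde W (n + 1)) : PiHat.a ρ n ω = PiHat.a ρ n 0 ↔
    ∃ α : π_ (n + 1) T pt,
      homologyToTilde W n (ρ.homologyMap n (hurewicz T n α).toAdd) = ω := by
  have hsq : ((-1 : ℤ) ^ (n + 1)) * (-1) ^ (n + 1) = 1 := by rw [← mul_pow]; simp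
  have hneg : ∀ e : ℤ, e * e = 1 → e = 1 ∨ e = -1 := fun e he => mul_self_eq_one_iff.1 he
  constructor
  · intro h
    obtain ⟨H, hH⟩ := (PiHat.mk_eq_mk ρ).1 h
    change 0 - ω = (-1 : ℤ) ^ (n + 1) • ρ.tilde (n + 1) H.chain at hH
    rw [zero_sub] at hH
    -- The relation reads `-ω = ±ρ(chain)`; if the sign is `+`, reversing the homotopy corrects it.
    rcases hneg _ hsq with he | he
    · rw [he, one_smul] at hH
      refine ⟨piMk H.symm.toCellularLoop.toLoop, ?_⟩
      rw [homologyToTilde_hurewicz, CellularHomotopy.cellularClass_toCellularLoop,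
        CellularHomotopy.chain_symm, map_neg, ← hH, neg_neg]
    · refine ⟨piMk H.toCellularLoop.toLoop, ?_⟩
      rw [homologyToTilde_hurewicz, CellularHomotopy.cellularClass_toCellularLoop]
      rw [he, neg_smul, one_smul, neg_inj] at hH
      exact hH.symm
  · rintro ⟨α, rfl⟩
    obtain ⟨f, rfl⟩ := exists_piMk_cellular α
    refine (PiHat.mk_eq_mk ρ).2 ?_
    rw [homologyToTilde_hurewicz, pairHomotopic_iff, zero_sub]
    rcases hneg _ hsq with he | he
    · refine ⟨f.toHomotopy.symm, ?_⟩
      rw [CellularHomotopy.chain_symm, CellularLoop.chain_toHomotopy, he, one_smul, map_neg]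
    · refine ⟨f.toHomotopy, ?_⟩
      rw [CellularLoop.chain_toHomotopy, he, neg_smul, one_smul]

end Exact

/-! ### The group structure -/

section GroupStructure

variable {W : ChainComplex AddCommGrpCat.{v} ℤ} (ρ : CellularChainMap T W)

lemma PairHomotopic.mul {f f' g g' : CellularLoop T (n + 1)} {ω ω' τ τ' : Wtilde W (n + 1 + 1)}
    (h : PairHomotopic ρ (n + 1) (f, ω) (f', ω')) (k : PairHomotopic ρ (n + 1) (g, τ) (g', τ')) :
    PairHomotopic ρ (n + 1) (f.mul g, ω + τ) (f'.mul g', ω' + τ') := by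
  obtain ⟨H, hH⟩ := (pairHomotopic_iff ρ).1 h
  obtain ⟨K, hK⟩ := (pairHomotopic_iff ρ).1 k
  refine (pairHomotopic_iff ρ).2 ⟨H.mul K, ?_⟩
  rw [CellularHomotopy.chain_mul, map_add, smul_add, ← hH, ← hK]
  exact add_sub_add_comm _ _ _ _

/-! ### Comparison with the homotopy group of the skeleton, and the group axioms -/

variable (T) in
/-- The base point of the skeleton. -/
def skelPt (n : ℕ) : skel T n := ⟨pt, pt_mem_skel T n⟩

/-- A cellular loop as a loop in the skeleton. -/
def CellularLoop.toSkel (f : CellularLoop T n) : GenLoop (Fin n) (skel T (n + 1)) (skelPt T _) :=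
  ⟨⟨fun y => ⟨f.toLoop y, f.cellular y⟩, f.toLoop.1.continuous.subtype_mk _⟩,
    fun y hy => Subtype.ext (f.toLoop.2 y hy)⟩

/-- A loop in the skeleton as a cellular loop. -/
def CellularLoop.ofSkel (p : GenLoop (Fin n) (skel T (n + 1)) (skelPt T _)) : CellularLoop T n :=
  ⟨⟨⟨fun y => (p y : T), continuous_subtype_val.comp p.1.continuous⟩,
    fun y hy => congrArg Subtype.val (p.2 y hy)⟩, fun y => (p y).2⟩

/-- The homotopy class of a cellular loop in the skeleton. -/
def CellularLoop.skelClass (f : CellularLoop T n) : π_ n (skel T (n + 1)) (skelPt T _) :=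
  Quotient.mk (GenLoop.Homotopic.setoid (Fin n) _) f.toSkel

lemma CellularLoop.exists_skelClass_eq (α : π_ n (skel T (n + 1)) (skelPt T _)) :
    ∃ f : CellularLoop T n, f.skelClass = α := by
  obtain ⟨p, rfl⟩ := Quotient.exists_rep α
  exact ⟨ofSkel p, rfl⟩

lemma CellularLoop.skelClass_const :
    (CellularLoop.const (n + 1) : CellularLoop T (n + 1)).skelClass = 1 :=
  rfl

lemma CellularLoop.skelClass_mul (f g : CellularLoop T (n + 1)) :
    (f.mul g).skelClass = g.skelClass * f.skelClass := by
  refine Eq.trans ?_ (HomotopyGroup.mul_spec (i := Fin.last n)).symm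
  refine congrArg _ (GenLoop.ext _ _ fun y => Subtype.ext ?_)
  change (f.mul g).toLoop y = ((if _ then _ else _ : skel T (n + 1 + 1)) : T)
  rw [CellularHomotopy.mul_apply]
  split_ifs <;> rfl

/-- Loops that are homotopic inside the skeleton give the same elements of `π̂ₙ(T, ρ)`. -/
lemma PiHat.mk_eq_of_skelClass_eq {f g : CellularLoop T n} (h : f.skelClass = g.skelClass)
    (ω : Wtilde W (n + 1)) : PiHat.mk ρ f ω = PiHat.mk ρ g ω := by
  obtain ⟨F, hb, h0, h1⟩ := exists_cube_of_homotopic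
    ((Quotient.eq (r := GenLoop.Homotopic.setoid (Fin n) _)).1 h)
  let H : CellularHomotopy f g := CellularHomotopy.ofCube
    ⟨fun y => (F y : T), continuous_subtype_val.comp F.continuous⟩
    (fun y => skel_subset_succ T _ (F y).2) (fun y j hj => congrArg Subtype.val (hb y j hj))
    (fun y hy => congrArg Subtype.val (h0 y hy)) (fun y hy => congrArg Subtype.val (h1 y hy))
  have hH : H.chain = 0 := H.chain_eq_zero fun y => by
    rw [show H.cube = _ from CellularHomotopy.cube_ofCube]
    exact (F y).2
  refine (PiHat.mk_eq_mk ρ).2 ((pairHomotopic_iff ρ).2 ⟨H, ?_⟩)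
  rw [hH, map_zero, smul_zero, sub_self]

/-- The product of `π̂ₙ₊₁(T, ρ)`. -/
def PiHat.mul : PiHat ρ (n + 1) → PiHat ρ (n + 1) → PiHat ρ (n + 1) :=
  Quot.map₂ (fun p q => (p.1.mul q.1, p.2 + q.2))
    -- One factor varies at a time, against the constant homotopy of the other.
    (fun _ _ _ h => PairHomotopic.mul ρ ((pairHomotopic_equivalence ρ _).refl _) h)
    (fun _ _ _ h => PairHomotopic.mul ρ h ((pairHomotopic_equivalence ρ _).refl _))

local instance : Mul (PiHat ρ (n + 1)) := ⟨PiHat.mul ρ⟩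

lemma PiHat.mk_mul_mk (f g : CellularLoop T (n + 1)) (ω τ : Wtilde W (n + 1 + 1)) :
    PiHat.mk ρ f ω * PiHat.mk ρ g τ = PiHat.mk ρ (f.mul g) (ω + τ) :=
  rfl

local instance : One (PiHat ρ (n + 1)) := ⟨PiHat.a ρ (n + 1) 0⟩

lemma PiHat.exists_mul_eq_one (x : PiHat ρ (n + 1)) : ∃ y, y * x = 1 := by
  induction x using PiHat.ind with
  | h f ω =>
    -- The inverse is taken in the homotopy group of the skeleton, so the contracting homotopy of
    -- the product has zero chain and `-ω` is the right second entry.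
    obtain ⟨g, hg⟩ := CellularLoop.exists_skelClass_eq f.skelClass⁻¹
    refine ⟨PiHat.mk ρ g (-ω), ?_⟩
    rw [PiHat.mk_mul_mk, neg_add_cancel]
    refine PiHat.mk_eq_of_skelClass_eq ρ ?_ 0
    rw [CellularLoop.skelClass_mul, hg, mul_inv_cancel, CellularLoop.skelClass_const]

local instance : Inv (PiHat ρ (n + 1)) := ⟨fun x => (PiHat.exists_mul_eq_one ρ x).choose⟩

local instance PiHat.group : Group (PiHat ρ (n + 1)) :=
  Group.ofLeftAxioms
    (fun x y z => by
      induction x using PiHat.ind with | h f ω => ?_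
      induction y using PiHat.ind with | h g τ => ?_
      induction z using PiHat.ind with | h k υ => ?_
      simp only [PiHat.mk_mul_mk, add_assoc]
      refine PiHat.mk_eq_of_skelClass_eq ρ ?_ _
      simp only [CellularLoop.skelClass_mul, mul_assoc])
    (fun x => by
      induction x using PiHat.ind with | h f ω => ?_
      change PiHat.mk ρ _ 0 * _ = _
      rw [PiHat.mk_mul_mk, zero_add]
      refine PiHat.mk_eq_of_skelClass_eq ρ ?_ _
      rw [CellularLoop.skelClass_mul, CellularLoop.skelClass_const, mul_one])
    (fun x => (PiHat.exists_mul_eq_one ρ x).choose_spec)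

lemma PiHat.a_add (ω τ : Wtilde W (n + 1 + 1)) :
    PiHat.a ρ (n + 1) (ω + τ) = PiHat.a ρ (n + 1) ω * PiHat.a ρ (n + 1) τ := by
  refine (PiHat.mk_eq_of_skelClass_eq ρ ?_ _).trans (PiHat.mk_mul_mk ρ _ _ _ _).symm
  rw [CellularLoop.skelClass_mul, CellularLoop.skelClass_const, mul_one]

lemma PiHat.zeta_mul (x y : PiHat ρ (n + 1)) :
    PiHat.zeta ρ (n + 1) (x * y) = PiHat.zeta ρ (n + 1) y * PiHat.zeta ρ (n + 1) x := by
  induction x using PiHat.ind with | h f ω => ?_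
  induction y using PiHat.ind with | h g τ => ?_
  exact piMk_mul f.toLoop g.toLoop

end GroupStructure

end

end ModifiedHomotopy

open ModifiedHomotopy PointedCWComplex
theorem mainTheorem2 {T : Type u} [TopologicalSpace T] [T2Space T] [PointedCWComplex T]
    (W : ChainComplex AddCommGrpCat.{v} ℤ) (ρ : CellularChainMap T W) :
    -- cellular homotopy of pairs is an equivalence relation
    (∀ n : ℕ, _root_.Equivalence (PairHomotopic ρ n)) ∧
    -- the sequence is an exact sequence of pointed sets, for all `n ≥ 0`
    (∀ n : ℕ, ∃ h : π_ (n + 1) T pt →* Multiplicative (CellularHomology T n),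
      IsHurewicz n (fun α => (h α).toAdd) ∧
      (∀ ω : Wtilde W (n + 1), PiHat.a ρ n ω = PiHat.a ρ n 0 ↔
        ∃ α : π_ (n + 1) T pt, homologyToTilde W n (ρ.homologyMap n (h α).toAdd) = ω) ∧
      (∀ x : PiHat ρ n, PiHat.zeta ρ n x = piMk GenLoop.const ↔
        ∃ ω : Wtilde W (n + 1), PiHat.a ρ n ω = x) ∧
      Function.Surjective (PiHat.zeta ρ n)) ∧
    -- in degrees `n + 1 ≥ 1` it is a sequence of groups and homomorphisms
    (∀ n : ℕ, ∃ _ : Group (PiHat ρ (n + 1)),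
      (∀ (f g : CellularLoop T (n + 1)) (ω τ : Wtilde W (n + 1 + 1)),
        PiHat.mk ρ f ω * PiHat.mk ρ g τ = PiHat.mk ρ (f.mul g) (ω + τ)) ∧
      (1 : PiHat ρ (n + 1)) = PiHat.a ρ (n + 1) 0 ∧
      (∀ ω τ : Wtilde W (n + 1 + 1),
        PiHat.a ρ (n + 1) (ω + τ) = PiHat.a ρ (n + 1) ω * PiHat.a ρ (n + 1) τ) ∧
      -- Mathlib's product on `π_` is `[f] * [g] = [g followed by f]`
      (∀ x y : PiHat ρ (n + 1),
        PiHat.zeta ρ (n + 1) (x * y) = PiHat.zeta ρ (n + 1) y * PiHat.zeta ρ (n + 1) x)) :=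
  ⟨pairHomotopic_equivalence ρ,
    fun n => ⟨hurewicz T n, isHurewicz_hurewicz, PiHat.a_eq_iff ρ, PiHat.zeta_eq_iff ρ,
      PiHat.zeta_surjective ρ n⟩,
    fun _ => ⟨PiHat.group ρ, PiHat.mk_mul_mk ρ, rfl, PiHat.a_add ρ, PiHat.zeta_mul ρ⟩⟩
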